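/- **Theorem 3.3.** Let $n\ge 3$, let $\Omega\subset\mathbb R^n$ be a bounded domain with smooth boundary and $0\in\Omega$, let $1<p<\frac{n+2}{n-2}$, and assume (A) $k\in C^1[0,+\infty)$, $k(0)>0$ and $k'(t)\ge 0$ for all $t\in[0,+\infty)$. For $u_0\in H_0^1(\Omega)$ consider the problem $$\frac{u_t}{|x|^2}-\Delta u=k(t)u^p\ \text{ in }\Omega\times(0,T),\qquad u=0\ \text{ on }\partial\Omega\times(0,T),\qquad u(x,0)=u_0(x)\ \text{ in }\Omega, \tag{P}$$ where $u^p$ stands for $|u|^{p-1}u$ (which is $u^p$ for $u\ge0$). A weak solution of (P) in $\Omega\times(0,T)$ is a function $u\in L^\infty(0,T;H_0^1(\Omega))$ with $\int_0^T\big\|\frac{u_t(t)}{|x|}\big\|_{L^2(\Omega)}^2\,dt<\infty$ and $u(0)=u_0$ (for the representative of $u$ that is continuous from $[0,T)$ into $L^2(\Omega)$) such that, for a.e. $t\in(0,T)$ and all $v\in H_0^1(\Omega)$, $$\int_\Omega \frac{u_t v}{|x|^2}\,dx+\int_\Omega\nabla u\cdot\nabla v\,dx=k(t)\int_\Omega u^p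 v\,dx .$$ We say that $u$ blows up at a finite time $T_0>0$ if $u$ is a weak solution in $\Omega\times(0,S)$ for every $S\in(0,T_0)$ and $\lim_{t\to T_0^-}\big\|\frac{u(t)}{|x|}\big\|_{L^2(\Omega)}^2=+\infty$; the maximal existence time of $u$ is then $T^*=T_0$. If $u$ is a weak solution in $\Omega\times(0,S)$ for every $S>0$ and blows up at no finite time, then $u$ is called global and its maximal existence time is $T^*=+\infty$. Put $$J(v;t)=\frac12\|\nabla v\|_{L^2(\Omega)}^2-\frac{k(t)}{p+1}\|v\|_{L^{p+1}(\Omega)}^{p+1},\quad L(t)=\frac12\Big\|\frac{u(t)}{|x|}\Big\|_{L^2(\Omega)}^2,\quad L(0)=\frac12\Big\|\frac{u_0}{|x|}\Big\|_{L^2(\Omega)}^2,\quad H_n=\frac{4}{(n-2)^2},\quad C_1=\frac{(p+1)H_n}{p-1}.$$ (1) Let $u_0\in H_0^1(\Omega)$ be nonnegative and nontrivial with $0<J(u_0;0)<\dfrac{L(0)}{C_1}$. If $u$ is a weak solution of (P) in $\Omega\times(0,T)$, then $$T\le \frac{8pH_nL(0)}{(p-1)^3\,[L(0)-C_1J(u_0;0)]};$$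 in particular no weak solution with initial datum $u_0$ is global. If $T^*$ is the maximal existence time of a solution $u$ with initial datum $u_0$, then $T^*<+\infty$, $u$ blows up at $T^*$, and $$T^*\le \frac{8pH_nL(0)}{(p-1)^3\,[L(0)-C_1J(u_0;0)]}.$$ (2) Such data exist at arbitrarily high initial energy: for every $R>0$ there is a nonnegative nontrivial $u_0\in H_0^1(\Omega)$ with $J(u_0;0)=R<\dfrac{L(0)}{C_1}$. -/

import Mathlib

open MeasureTheory Filter Topology
open scoped ContDiff Gradient

noncomputable section

namespace SpecialDiffusion

/-- Euclidean space `ℝⁿ`. -/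
abbrev E (n : ℕ) := EuclideanSpace ℝ (Fin n)

/-- A bounded domain (nonempty, open, connected) of `ℝⁿ` containing the origin, with smooth
boundary: near each boundary point the domain is a strict sublevel set `{ρ < 0}` of a smooth
function `ρ` without critical point at that boundary point. -/
structure IsSmoothBoundedDomain {n : ℕ} (Ω : Set (E n)) : Prop where
  isOpen : IsOpen Ω
  isConnected : IsConnected Ω
  isBounded : Bornology.IsBounded Ω
  zero_mem : (0 : E n) ∈ Ω
  smooth_boundary : ∀ x ∈ frontier Ω, ∃ ρ : E n → ℝ,
    ContDiff ℝ ∞ ρ ∧ fderiv ℝ ρ x ≠ 0 ∧ ∀ᶠ y in 𝓝 x, (y ∈ Ω ↔ ρ y < 0)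

/-- `φ ∈ C_c^∞(Ω)`. -/
def IsTestFunction {n : ℕ} (Ω : Set (E n)) (φ : E n → ℝ) : Prop :=
  ContDiff ℝ ∞ φ ∧ HasCompactSupport φ ∧ tsupport φ ⊆ Ω

/-- `L²(Ω)`. -/
abbrev L2 {n : ℕ} (Ω : Set (E n)) := Lp ℝ 2 (volume.restrict Ω)

/-- `L²(Ω; ℝⁿ)`. -/
abbrev L2Vec {n : ℕ} (Ω : Set (E n)) := Lp (E n) 2 (volume.restrict Ω)

/-- The Sobolev space `H₀¹(Ω)`, the closure of `C_c^∞(Ω)` in the norm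
`(‖v‖₂² + ‖∇v‖₂²)^{1/2}`. A function `v` is recorded together with its weak gradient, as the pair
`(v, ∇v) ∈ L²(Ω) × L²(Ω; ℝⁿ)`; so the space is the closure of the linear space of the pairs
`(φ, ∇φ)` with `φ ∈ C_c^∞(Ω)`. -/
def H01 {n : ℕ} (Ω : Set (E n)) : Submodule ℝ (WithLp 2 (L2 Ω × L2Vec Ω)) :=
  (Submodule.span ℝ {z | ∃ φ : E n → ℝ, IsTestFunction Ω φ ∧
    z.fst =ᵐ[volume.restrict Ω] φ ∧ z.snd =ᵐ[volume.restrict Ω] ∇ φ}).topologicalClosure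

/-- The function `v ∈ L²(Ω)` underlying an element of `H₀¹(Ω)`. -/
def fn {n : ℕ} {Ω : Set (E n)} (v : H01 Ω) : L2 Ω := (v : WithLp 2 (L2 Ω × L2Vec Ω)).fst

/-- The weak gradient `∇v ∈ L²(Ω; ℝⁿ)` of an element of `H₀¹(Ω)`. -/
def grad {n : ℕ} {Ω : Set (E n)} (v : H01 Ω) : L2Vec Ω :=
  (v : WithLp 2 (L2 Ω × L2Vec Ω)).snd

/-- Assumption (A): `k ∈ C¹[0,∞)`, `k(0) > 0` and `k' ≥ 0` on `[0,∞)`. -/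
structure AssumptionA (k : ℝ → ℝ) : Prop where
  contDiffOn : ContDiffOn ℝ 1 k (Set.Ici 0)
  pos : 0 < k 0
  deriv_nonneg : ∀ t ∈ Set.Ici (0 : ℝ), 0 ≤ derivWithin k (Set.Ici 0) t

/-- The energy `J(v; t) = ½ ‖∇v‖₂² - k(t)/(p+1) ‖v‖_{p+1}^{p+1}`. -/
def energy {n : ℕ} {Ω : Set (E n)} (p : ℝ) (k : ℝ → ℝ) (v : H01 Ω) (t : ℝ) : ℝ :=
  1 / 2 * (∫ x in Ω, ‖grad v x‖ ^ 2) - k t / (p + 1) * ∫ x in Ω, |fn v x| ^ (p + 1)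

/-- `‖v / |x|‖₂²`. -/
def weightedNormSq {n : ℕ} {Ω : Set (E n)} (v : H01 Ω) : ℝ :=
  ∫ x in Ω, (|fn v x| / ‖x‖) ^ 2

/-- The constant `H_n = 4 / (n-2)²` of the Hardy inequality. -/
def hardyConst (n : ℕ) : ℝ := 4 / ((n : ℝ) - 2) ^ 2

/-- `C₁ = (p+1) H_n / (p-1)`. -/
def C₁ (n : ℕ) (p : ℝ) : ℝ := (p + 1) * hardyConst n / (p - 1)

/-- `u` is a weak solution in `Ω × (0,T)` of
`u_t / |x|² - Δu = k(t) u^p`, `u = 0` on `∂Ω × (0,T)`, `u(·,0) = u₀`.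

* `u ∈ L^∞(0,T; H₀¹(Ω))`;
* `u` is given by its representative that is continuous in time: `u(t) = u₀ + ∫₀ᵗ u_t(s) ds` in
  `L²(Ω)` for all `t ∈ [0,T)`, where `w = u_t` satisfies `∫₀ᵀ ‖u_t / |x|‖₂² dt < ∞`;
* `(u_t/|x|², v) + (∇u, ∇v) = k(t) (u^p, v)` for a.e. `t ∈ (0,T)` and all `v ∈ H₀¹(Ω)`.

The power `u^p` is written `|u|^{p-1} u`, which is `u^p` where `u ≥ 0` and makes sense
for real-valued `u`; the nonnegativity of `u` is not assumed. -/
structure IsWeakSolution {n : ℕ} {Ω : Set (E n)} (p : ℝ) (k : ℝ → ℝ) (u₀ : H01 Ω)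
    (u : ℝ → H01 Ω) (T : ℝ) : Prop where
  pos : 0 < T
  memLp : MemLp u ⊤ (volume.restrict (Set.Ioo 0 T))
  init : u 0 = u₀
  weak : ∃ w : ℝ → L2 Ω,
    AEStronglyMeasurable w (volume.restrict (Set.Ioo 0 T)) ∧
    (∫⁻ t in Set.Ioo 0 T, ∫⁻ x in Ω, (‖w t x‖ₑ / ‖x‖ₑ) ^ 2) < ⊤ ∧
    (∀ t ∈ Set.Ico 0 T, fn (u t) = fn u₀ + ∫ s in (0 : ℝ)..t, w s) ∧
    ∀ᵐ t ∂(volume.restrict (Set.Ioo 0 T)), ∀ v : H01 Ω,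
      (∫ x in Ω, w t x * fn v x / ‖x‖ ^ 2) + (∫ x in Ω, inner ℝ (grad (u t) x) (grad v x)) =
        k t * ∫ x in Ω, (|fn (u t) x| ^ (p - 1) * fn (u t) x) * fn v x

/-- `u` blows up at the finite time `T₀`: it exists for all `t ∈ [0,T₀)` (it is a weak solution
in `Ω × (0,S)` for all `S < T₀`) and `‖u(t)/|x|‖₂² → ∞` as `t → T₀`. -/
def BlowsUpAt {n : ℕ} {Ω : Set (E n)} (p : ℝ) (k : ℝ → ℝ) (u₀ : H01 Ω)
    (u : ℝ → H01 Ω) (T₀ : ℝ) : Prop :=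
  0 < T₀ ∧ (∀ S ∈ Set.Ioo 0 T₀, IsWeakSolution p k u₀ u S) ∧
    Tendsto (fun t => weightedNormSq (u t)) (𝓝[<] T₀) atTop

/-- `u` is a global solution: it exists for all times and blows up at no finite time. -/
def IsGlobalSolution {n : ℕ} {Ω : Set (E n)} (p : ℝ) (k : ℝ → ℝ) (u₀ : H01 Ω)
    (u : ℝ → H01 Ω) : Prop :=
  (∀ S, 0 < S → IsWeakSolution p k u₀ u S) ∧ ∀ T₀ : ℝ, ¬ BlowsUpAt p k u₀ u T₀

/-- `Tmax` is the maximal existence time of the solution `u`: the blow-up time if `u` blows up at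
a finite time, and `+∞` if `u` is global. -/
def IsMaximalExistenceTime {n : ℕ} {Ω : Set (E n)} (p : ℝ) (k : ℝ → ℝ) (u₀ : H01 Ω)
    (u : ℝ → H01 Ω) (Tmax : EReal) : Prop :=
  (∃ T₀ : ℝ, Tmax = T₀ ∧ BlowsUpAt p k u₀ u T₀) ∨ (Tmax = ⊤ ∧ IsGlobalSolution p k u₀ u)

/-- The bound `8 p H_n L(0) / ((p-1)³ [L(0) - C₁ J(u₀;0)])`, with `L(0) = ½ ‖u₀/|x|‖₂²`. -/
def blowUpBound {n : ℕ} {Ω : Set (E n)} (p : ℝ) (k : ℝ → ℝ) (u₀ : H01 Ω) : ℝ :=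
  8 * p * hardyConst n * (1 / 2 * weightedNormSq u₀) /
    ((p - 1) ^ 3 * (1 / 2 * weightedNormSq u₀ - C₁ n p * energy p k u₀ 0))

end SpecialDiffusion

end

/-! Dividing by |x| turns the problem into an evolution in the Hilbert space L²(Ω): U = u/|x| is a
primitive of the square integrable function W = u_t/|x|. Testing the equation with u itself gives
⟨U, W⟩ = (p-1)/2 ‖∇u‖² - (p+1) J(u;t). Hardy's inequality bounds ‖∇u‖² below by ‖U‖²/H_n, and the
energy inequality J(u(t);t) + ∫₀ᵗ ‖W‖² ≤ J(u₀;0) bounds J above. What remains is a differential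
inequality for ‖U‖² in an abstract Hilbert space, and Levine's concavity method (`le_of_concavity`)
turns it into the bound on T.

The delicate point is the energy inequality, since u is only bounded in time with values in H₀¹ and
J(u(t);t) cannot be differentiated. Finite differences replace the derivative. Testing the equation
at time t with u(t) - u(s), the Dirichlet term leaves a surplus ½‖∇(u(t) - u(s))‖². The exponent is
subcritical, so this surplus absorbs the Taylor remainder of the power term, up to C ‖U(t) - U(s)‖²
(`exists_taylor_remainder_bound`); monotonicity of k takes care of the explicit time dependence
(`exists_energy_step_bound`). Putting s = t - h, integrating over t, dividing by h and letting h → 0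
gives the energy inequality at almost every time (`ae_add_integral_norm_sq_le`): the differences of
J telescope, the main term tends to -∫ ‖W‖² by continuity of translations in L², and the quadratic
error vanishes.

For data of prescribed energy R, a large multiple of a fixed nonnegative function has energy at most
R and weighted norm as large as desired. Adding a concentrated nonnegative bump with bounded L^{p+1}
norm and huge gradient lifts the energy to at least R; this is possible because p + 1 < 2*. The
intermediate value theorem on the segment between the two gives energy exactly R, and the added
nonnegative part does not lower the weighted norm. -/

/-! ### Absolutely continuous functions -/

/-- Absolute continuity passes from `g` to `f` if the oscillations of `f` are dominated by those
of `g`. -/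
theorem AbsolutelyContinuousOnInterval.of_dist_le {X Y : Type*} [PseudoMetricSpace X]
    [PseudoMetricSpace Y] {f : ℝ → X} {g : ℝ → Y} {a b K : ℝ}
    (hg : AbsolutelyContinuousOnInterval g a b)
    (h : ∀ x ∈ Set.uIcc a b, ∀ y ∈ Set.uIcc a b, dist (f x) (f y) ≤ K * dist (g x) (g y)) :
    AbsolutelyContinuousOnInterval f a b := by
  rw [absolutelyContinuousOnInterval_iff] at hg ⊢
  intro ε hε
  have hK : 0 < |K| + 1 := by positivity
  obtain ⟨δ, hδ, H⟩ := hg (ε / (|K| + 1)) (by positivity)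
  refine ⟨δ, hδ, fun I hI hIδ => ?_⟩
  have h1 := H I hI hIδ
  calc ∑ i ∈ Finset.range I.1, dist (f (I.2 i).1) (f (I.2 i).2)
      ≤ ∑ i ∈ Finset.range I.1, (|K| + 1) * dist (g (I.2 i).1) (g (I.2 i).2) := by
        refine Finset.sum_le_sum fun i hi => ?_
        refine (h _ (hI.1 i hi).1 _ (hI.1 i hi).2).trans ?_
        gcongr
        linarith [le_abs_self K]
    _ = (|K| + 1) * ∑ i ∈ Finset.range I.1, dist (g (I.2 i).1) (g (I.2 i).2) := by
        rw [Finset.mul_sum]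
    _ < (|K| + 1) * (ε / (|K| + 1)) := by gcongr
    _ = ε := by field_simp

/-- An absolutely continuous function with a.e. nonnegative derivative does not decrease. -/
theorem AbsolutelyContinuousOnInterval.le_of_deriv_nonneg {f : ℝ → ℝ} {a b : ℝ} (hab : a ≤ b)
    (hf : AbsolutelyContinuousOnInterval f a b)
    (h : ∀ᵐ x, x ∈ Set.Ioo a b → 0 ≤ deriv f x) : f a ≤ f b := by
  rw [← sub_nonneg, ← hf.integral_deriv_eq_sub]
  apply intervalIntegral.integral_nonneg_of_ae_restrict hab
  rw [← Measure.restrict_congr_set Ioo_ae_eq_Icc]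
  exact (ae_restrict_iff' measurableSet_Ioo).2 h

namespace SpecialDiffusion

theorem intervalIntegrable_of_memLp_two {H : Type*} [NormedAddCommGroup H] {W : ℝ → H}
    (hW : MemLp W 2 volume) (a b : ℝ) :
    IntervalIntegrable W volume a b := by
  have : LocallyIntegrable W volume := hW.locallyIntegrable (by norm_num)
  exact intervalIntegrable_iff.mpr <|
      (this.integrableOn_isCompact isCompact_uIcc).mono_set Set.uIoc_subset_uIcc

theorem integrable_norm_sq_of_memLp {H : Type*} [NormedAddCommGroup H] {W : ℝ → H}
    (hW : MemLp W 2 volume) :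
    Integrable (fun t => ‖W t‖ ^ 2) := hW.integrable_norm_pow (by norm_num)

/-! ### Primitives of L² functions and Levine's concavity method -/

section Hilbert

variable {H : Type*} [NormedAddCommGroup H] [InnerProductSpace ℝ H]

/-- The function with initial value `a` and time derivative `W`. -/
noncomputable def primitive (a : H) (W : ℝ → H) (t : ℝ) : H := a + ∫ s in (0 : ℝ)..t, W s

theorem primitive_zero (a : H) (W : ℝ → H) : primitive a W 0 = a := by simp [primitive]

theorem primitive_sub {W : ℝ → H} (hW : MemLp W 2 volume) (a : H) (s t : ℝ) :
    primitive a W t - primitive a W s = ∫ r in s..t, W r := by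
  have := intervalIntegrable_of_memLp_two hW
  simp only [primitive, add_sub_add_left_eq_sub]
  rw [intervalIntegral.integral_interval_sub_left (this _ _) (this _ _)]

theorem continuous_primitive {W : ℝ → H} (hW : MemLp W 2 volume) (a : H) :
    Continuous (primitive a W) :=
  continuous_const.add (intervalIntegral.continuous_primitive
    (intervalIntegrable_of_memLp_two hW) 0)

/-- U is bounded by some M on the interval, so ‖U‖² oscillates at most 2M times as much as the
scalar primitive of ‖W‖. This gives the fundamental theorem of calculus for ‖U‖² although U is
differentiable only almost everywhere. -/
theorem absolutelyContinuous_norm_sq_primitive {W : ℝ → H} (hW : MemLp W 2 volume) (a₀ : H)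
    (a b : ℝ) : AbsolutelyContinuousOnInterval (fun t => ‖primitive a₀ W t‖ ^ 2) a b := by
  have hi := intervalIntegrable_of_memLp_two hW
  obtain ⟨M, hM⟩ := (isCompact_uIcc (a := a) (b := b)).exists_bound_of_continuousOn
    (continuous_primitive hW a₀).continuousOn
  have hA := (hi a b).norm.absolutelyContinuousOnInterval_intervalIntegral
    (c := a) Set.left_mem_uIcc
  refine hA.of_dist_le (K := 2 * M) fun x hx y hy => ?_
  have h1 : |‖primitive a₀ W x‖ - ‖primitive a₀ W y‖| ≤
      |(∫ v in a..x, ‖W v‖) - ∫ v in a..y, ‖W v‖| := by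
    refine (abs_norm_sub_norm_le _ _).trans ?_
    rw [primitive_sub hW, intervalIntegral.integral_interval_sub_left ((hi _ _).norm)
      ((hi _ _).norm)]
    exact intervalIntegral.norm_integral_le_abs_integral_norm
  have h2 : |‖primitive a₀ W x‖ + ‖primitive a₀ W y‖| ≤ 2 * M := by
    rw [abs_of_nonneg (by positivity)]
    linarith [hM x hx, hM y hy]
  rw [Real.dist_eq, Real.dist_eq, sq_sub_sq, abs_mul]
  exact mul_le_mul h2 h1 (abs_nonneg _) ((abs_nonneg _).trans h2)

theorem intervalIntegrable_inner_primitive {W : ℝ → H} (hW : MemLp W 2 volume) (a₀ : H)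
    (a b : ℝ) :
    IntervalIntegrable (fun t => inner ℝ (primitive a₀ W t) (W t)) volume a b := by
  have hi := intervalIntegrable_of_memLp_two hW a b
  obtain ⟨M, hM⟩ := (isCompact_uIcc (a := a) (b := b)).exists_bound_of_continuousOn
    (continuous_primitive hW a₀).continuousOn
  refine (hi.norm.const_mul M).mono_fun
    ((continuous_primitive hW a₀).aestronglyMeasurable.inner
      (intervalIntegrable_iff.1 hi).aestronglyMeasurable) ?_
  filter_upwards [ae_restrict_mem measurableSet_uIoc] with t ht
  refine (norm_inner_le_norm _ _).trans ?_
  rw [norm_mul, norm_norm]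
  gcongr
  exact (hM t (Set.uIoc_subset_uIcc ht)).trans (le_abs_self M)

/-- Cauchy–Schwarz in L²(0,t;H) ⊕ ℝ for the pairs (U, √β τ) and (W, √β), obtained from the
discriminant of a nonnegative quadratic polynomial in l. -/
theorem integral_inner_primitive_add_sq_le {W : ℝ → H} (hW : MemLp W 2 volume) (a₀ : H)
    {t β : ℝ} (τ : ℝ) (ht : 0 ≤ t) (hβ : 0 ≤ β) :
    ((∫ s in (0 : ℝ)..t, inner ℝ (primitive a₀ W s) (W s)) + β * τ) ^ 2 ≤
      ((∫ s in (0 : ℝ)..t, ‖primitive a₀ W s‖ ^ 2) + β * τ ^ 2) *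
        ((∫ s in (0 : ℝ)..t, ‖W s‖ ^ 2) + β) := by
  have i1 : IntervalIntegrable (fun s => ‖primitive a₀ W s‖ ^ 2) volume 0 t :=
    ((continuous_primitive hW a₀).norm.pow 2).intervalIntegrable _ _
  have i2 := intervalIntegrable_inner_primitive hW a₀ 0 t
  have i3 : IntervalIntegrable (fun s => ‖W s‖ ^ 2) volume 0 t :=
    (integrable_norm_sq_of_memLp hW).intervalIntegrable
  have key : ∀ l : ℝ, 0 ≤ ((∫ s in (0 : ℝ)..t, ‖W s‖ ^ 2) + β) * (l * l) +
      (-2 * ((∫ s in (0 : ℝ)..t, inner ℝ (primitive a₀ W s) (W s)) + β * τ)) * l +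
      ((∫ s in (0 : ℝ)..t, ‖primitive a₀ W s‖ ^ 2) + β * τ ^ 2) := by
    intro l
    have h0 : 0 ≤ ∫ s in (0 : ℝ)..t, ‖primitive a₀ W s - l • W s‖ ^ 2 :=
      intervalIntegral.integral_nonneg ht fun _ _ => by positivity
    have h1 : ∫ s in (0 : ℝ)..t, ‖primitive a₀ W s - l • W s‖ ^ 2 =
        (∫ s in (0 : ℝ)..t, ‖primitive a₀ W s‖ ^ 2) -
        (2 * l) * (∫ s in (0 : ℝ)..t, inner ℝ (primitive a₀ W s) (W s)) +
        l ^ 2 * (∫ s in (0 : ℝ)..t, ‖W s‖ ^ 2) := by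
      rw [← intervalIntegral.integral_const_mul, ← intervalIntegral.integral_const_mul,
        ← intervalIntegral.integral_sub i1 (i2.const_mul _),
        ← intervalIntegral.integral_add (i1.sub (i2.const_mul _)) (i3.const_mul _)]
      refine intervalIntegral.integral_congr fun s _ => ?_
      simp only [norm_sub_sq_real, inner_smul_right, norm_smul, mul_pow, Real.norm_eq_abs, sq_abs]
      ring
    nlinarith [mul_nonneg hβ (sq_nonneg (τ - l))]
  have := discrim_le_zero key
  rw [discrim] at this
  nlinarith

variable [CompleteSpace H]

theorem ae_hasDerivAt_primitive {W : ℝ → H} (hW : MemLp W 2 volume) (a₀ : H) :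
    ∀ᵐ t, HasDerivAt (primitive a₀ W) (W t) t := by
  have : LocallyIntegrable W volume := hW.locallyIntegrable (by norm_num)
  filter_upwards [LocallyIntegrable.ae_hasDerivAt_integral this] with t ht
  exact (ht 0).const_add a₀

theorem ae_hasDerivAt_norm_sq_primitive {W : ℝ → H} (hW : MemLp W 2 volume) (a₀ : H) :
    ∀ᵐ t, HasDerivAt (fun t => ‖primitive a₀ W t‖ ^ 2)
      (2 * inner ℝ (primitive a₀ W t) (W t)) t := by
  filter_upwards [ae_hasDerivAt_primitive hW a₀] with t ht using ht.norm_sq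

theorem two_mul_integral_inner_primitive {W : ℝ → H} (hW : MemLp W 2 volume) (a₀ : H) (t : ℝ) :
    2 * ∫ s in (0 : ℝ)..t, inner ℝ (primitive a₀ W s) (W s) =
      ‖primitive a₀ W t‖ ^ 2 - ‖a₀‖ ^ 2 := by
  have h := (absolutelyContinuous_norm_sq_primitive hW a₀ 0 t).integral_deriv_eq_sub
  rw [primitive_zero] at h
  rw [← h, ← intervalIntegral.integral_const_mul]
  apply intervalIntegral.integral_congr_ae
  filter_upwards [ae_hasDerivAt_norm_sq_primitive hW a₀] with s hs _ using hs.deriv.symm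

set_option maxHeartbeats 800000 in
/-- The concavity method: if `U = primitive a₀ W` satisfies
`⟪U, U'⟫ ≥ (c/2) ‖U‖² - (p+1) (J₀ - ∫₀ᵗ ‖U'‖²)` on `(0,T)` and the right-hand side is positive at
time `0`, then `T` is bounded in terms of the data. -/
theorem le_of_concavity {W : ℝ → H} (hW : MemLp W 2 volume) (a₀ : H) {T c p J₀ : ℝ}
    (hT : 0 < T) (hc : 0 < c) (hp : 1 < p) (hJ : 0 ≤ J₀)
    (h : ∀ᵐ t, t ∈ Set.Ioo 0 T → c / 2 * ‖primitive a₀ W t‖ ^ 2 -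
      (p + 1) * (J₀ - ∫ s in (0 : ℝ)..t, ‖W s‖ ^ 2) ≤ inner ℝ (primitive a₀ W t) (W t))
    (hm : 0 < c / 2 * ‖a₀‖ ^ 2 - (p + 1) * J₀) :
    T ≤ 4 * p * ‖a₀‖ ^ 2 / ((p - 1) ^ 2 * (c / 2 * ‖a₀‖ ^ 2 - (p + 1) * J₀)) := by
  set m := c / 2 * ‖a₀‖ ^ 2 - (p + 1) * J₀ with hmdef
  have ha : 0 < ‖a₀‖ ^ 2 := by
    by_contra hcon
    have : ‖a₀‖ ^ 2 = 0 := le_antisymm (not_lt.1 hcon) (by positivity)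
    have : 0 ≤ (p + 1) * J₀ := by positivity
    simp_all
    linarith
  have hU := continuous_primitive hW a₀
  have hB : ∀ t, 0 ≤ t → 0 ≤ ∫ s in (0 : ℝ)..t, ‖W s‖ ^ 2 := fun t ht =>
    intervalIntegral.integral_nonneg ht fun _ _ => by positivity
  have hd := ae_hasDerivAt_norm_sq_primitive hW a₀
  -- Integrating factor: f = (c/2)‖U‖² - (p+1)J₀ satisfies f' ≥ c f because the term ∫‖W‖² has the
  -- favourable sign. Hence e^{-ct} f does not decrease, and f ≥ m.
  have hL : ∀ t ∈ Set.Icc 0 T, ‖a₀‖ ^ 2 ≤ ‖primitive a₀ W t‖ ^ 2 := by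
    intro t ht
    have hac : AbsolutelyContinuousOnInterval (fun t => Real.exp (-(c * t)) *
        (c / 2 * ‖primitive a₀ W t‖ ^ 2 - (p + 1) * J₀)) 0 t := by
      refine AbsolutelyContinuousOnInterval.fun_mul ?_ ?_
      · exact ContDiffOn.absolutelyContinuousOnInterval (by fun_prop)
      · refine ((absolutelyContinuous_norm_sq_primitive hW a₀ 0 t).const_mul (c / 2)).fun_sub ?_
        exact ContDiffOn.absolutelyContinuousOnInterval (by fun_prop)
    have hmono := hac.le_of_deriv_nonneg ht.1 (by
      filter_upwards [h, hd] with x hx hdx hxt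
      have hx' := hx ⟨hxt.1, hxt.2.trans_le ht.2⟩
      have e1 : HasDerivAt (fun t => Real.exp (-(c * t))) (Real.exp (-(c * x)) * (-(c * 1))) x :=
        (((hasDerivAt_id x).const_mul c).neg).exp
      rw [(e1.fun_mul ((hdx.const_mul (c / 2)).sub_const ((p + 1) * J₀))).deriv]
      have hBx := mul_nonneg (by linarith : (0:ℝ) ≤ p + 1) (hB x hxt.1.le)
      have : 0 ≤ Real.exp (-(c * x)) * (c * (inner ℝ (primitive a₀ W x) (W x) -
          (c / 2 * ‖primitive a₀ W x‖ ^ 2 - (p + 1) * J₀))) :=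
        mul_nonneg (Real.exp_pos _).le (mul_nonneg hc.le (by nlinarith))
      nlinarith)
    simp only [mul_zero, neg_zero, Real.exp_zero, one_mul, primitive_zero] at hmono
    rw [← hmdef] at hmono
    have hpos : 0 < c / 2 * ‖primitive a₀ W t‖ ^ 2 - (p + 1) * J₀ :=
      pos_of_mul_pos_right (hm.trans_le hmono) (Real.exp_pos _).le
    have : m ≤ c / 2 * ‖primitive a₀ W t‖ ^ 2 - (p + 1) * J₀ :=
      hmono.trans (mul_le_of_le_one_left hpos.le
        (Real.exp_le_one_iff.2 (by have := mul_nonneg hc.le ht.1; linarith)))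
    rw [hmdef] at this
    have : c / 2 * ‖a₀‖ ^ 2 ≤ c / 2 * ‖primitive a₀ W t‖ ^ 2 := by linarith
    exact le_of_mul_le_mul_left this (by positivity)
  -- β is chosen so that 2m + 2β = 2(p+1)β, which is what `hG''` needs. The value of σ below
  -- minimises the resulting bound βσ² / ((p-1)βσ - ‖a₀‖²) on T.
  set β := m / p with hβ
  have hβ0 : 0 < β := by positivity
  have hp1 : 0 < p - 1 := by linarith
  set σ := 2 * ‖a₀‖ ^ 2 / ((p - 1) * β) with hσ
  have hσ0 : 0 < σ := by positivity
  -- Levine's functional. The term (T - t)‖a₀‖² subtracts ‖a₀‖² in G', so that G' is twice the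
  -- quantity squared in the Cauchy–Schwarz lemma, and it stays nonnegative up to T.
  set G : ℝ → ℝ := fun t => (∫ s in (0 : ℝ)..t, ‖primitive a₀ W s‖ ^ 2) + (T - t) * ‖a₀‖ ^ 2 +
    β * (t + σ) ^ 2 with hG
  set G' : ℝ → ℝ := fun t => ‖primitive a₀ W t‖ ^ 2 - ‖a₀‖ ^ 2 + 2 * β * (t + σ) with hG'
  have hGd : ∀ t, HasDerivAt G (G' t) t := by
    intro t
    have e1 : HasDerivAt (fun t => ∫ s in (0 : ℝ)..t, ‖primitive a₀ W s‖ ^ 2)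
        (‖primitive a₀ W t‖ ^ 2) t :=
      intervalIntegral.integral_hasDerivAt_right ((hU.norm.pow 2).intervalIntegrable _ _)
        ((hU.norm.pow 2).stronglyMeasurableAtFilter _ _) (hU.norm.pow 2).continuousAt
    have e2 : HasDerivAt (fun t => (T - t) * ‖a₀‖ ^ 2) ((-1) * ‖a₀‖ ^ 2) t :=
      ((hasDerivAt_id t).const_sub T).mul_const _
    have e3 : HasDerivAt (fun t => β * (t + σ) ^ 2)
        (β * (((2 : ℕ) : ℝ) * (t + σ) ^ (2 - 1) * 1)) t :=
      (((hasDerivAt_id t).add_const σ).pow 2).const_mul β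
    refine ((e1.add e2).add e3).congr_deriv ?_
    simp only [hG']
    norm_num
    ring
  have hA0 : ∀ t, 0 ≤ t → 0 ≤ ∫ s in (0 : ℝ)..t, ‖primitive a₀ W s‖ ^ 2 := fun t ht =>
    intervalIntegral.integral_nonneg ht fun _ _ => by positivity
  have hGpos : ∀ t ∈ Set.Icc 0 T, 0 < G t := by
    intro t ht
    have := hA0 t ht.1
    have h2 : 0 ≤ (T - t) * ‖a₀‖ ^ 2 := mul_nonneg (by linarith [ht.2]) ha.le
    have h3 : 0 < β * (t + σ) ^ 2 := by
      have := ht.1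
      positivity
    simp only [hG]
    linarith
  have hGC : ContDiff ℝ 1 G := by
    rw [contDiff_one_iff_deriv]
    refine ⟨fun t => (hGd t).differentiableAt, ?_⟩
    rw [show deriv G = G' from funext fun t => (hGd t).deriv]
    fun_prop
  -- Up to the factor -(p-1)/2 this is the derivative of G^{-(p-1)/2}, so concavity of that power
  -- means that q does not decrease. Since G'' exists only almost everywhere, this goes through
  -- absolute continuity; the sign of q' is that of G''G - (p+1)/2 G'².
  set q : ℝ → ℝ := fun t => G' t * G t ^ (-((p + 1) / 2)) with hq
  have hqmono : ∀ t ∈ Set.Icc 0 T, q 0 ≤ q t := by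
    intro t ht
    have hsub : Set.uIcc 0 t ⊆ Set.Icc 0 T := by
      rw [Set.uIcc_of_le ht.1]
      exact Set.Icc_subset_Icc_right ht.2
    have hac : AbsolutelyContinuousOnInterval q 0 t := by
      refine AbsolutelyContinuousOnInterval.fun_mul ?_ ?_
      · refine AbsolutelyContinuousOnInterval.fun_add
          ((absolutelyContinuous_norm_sq_primitive hW a₀ 0 t).fun_sub ?_) ?_
        · exact ContDiffOn.absolutelyContinuousOnInterval (by fun_prop)
        · exact ContDiffOn.absolutelyContinuousOnInterval (by fun_prop)
      · refine ContDiffOn.absolutelyContinuousOnInterval ?_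
        exact hGC.contDiffOn.rpow_const_of_ne fun x hx => (hGpos x (hsub hx)).ne'
    refine hac.le_of_deriv_nonneg ht.1 ?_
    filter_upwards [h, hd] with x hx hdx hxt
    have hxT : x ∈ Set.Ioo 0 T := ⟨hxt.1, hxt.2.trans_le ht.2⟩
    have hx' := hx hxT
    have hGx := hGpos x ⟨hxT.1.le, hxT.2.le⟩
    have e1 : HasDerivAt G' (2 * inner ℝ (primitive a₀ W x) (W x) + 2 * β * 1) x :=
      (hdx.sub_const _).add (((hasDerivAt_id x).add_const σ).const_mul (2 * β))
    have e2 := (hGd x).rpow_const (p := -((p + 1) / 2)) (Or.inl hGx.ne')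
    rw [hq, (e1.fun_mul e2).deriv]
    have hCS := integral_inner_primitive_add_sq_le hW a₀ (x + σ) hxT.1.le hβ0.le
    have hG'x : G' x = 2 * ((∫ s in (0 : ℝ)..x, inner ℝ (primitive a₀ W s) (W s)) +
        β * (x + σ)) := by
      simp only [hG']
      linarith [two_mul_integral_inner_primitive hW a₀ x]
    set B := ∫ s in (0 : ℝ)..x, ‖W s‖ ^ 2 with hBdef
    have hB0 := hB x hxT.1.le
    have hGge : (∫ s in (0 : ℝ)..x, ‖primitive a₀ W s‖ ^ 2) + β * (x + σ) ^ 2 ≤ G x := by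
      have h2 : 0 ≤ (T - x) * ‖a₀‖ ^ 2 := mul_nonneg (by linarith [hxT.2]) ha.le
      simp only [hG]
      linarith
    have hsq : G' x ^ 2 ≤ 4 * (G x * (B + β)) := by
      rw [hG'x, mul_pow]
      have := hCS.trans (mul_le_mul_of_nonneg_right hGge (by linarith))
      linarith
    have hG'' : 2 * (p + 1) * (B + β) ≤ 2 * inner ℝ (primitive a₀ W x) (W x) + 2 * β * 1 := by
      have h1 := hL x ⟨hxT.1.le, hxT.2.le⟩
      have h2 : c / 2 * ‖a₀‖ ^ 2 ≤ c / 2 * ‖primitive a₀ W x‖ ^ 2 :=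
        mul_le_mul_of_nonneg_left h1 (by positivity)
      have h3 : p * β = m := by rw [hβ]; field_simp
      nlinarith
    have e3 : G x ^ (-((p + 1) / 2)) = G x * G x ^ (-((p + 1) / 2) - 1) := by
      rw [Real.rpow_sub_one hGx.ne']
      field_simp
    rw [e3]
    have hP : 0 < G x ^ (-((p + 1) / 2) - 1) := Real.rpow_pos_of_pos hGx _
    have hfin : 0 ≤ (2 * inner ℝ (primitive a₀ W x) (W x) + 2 * β * 1) * G x -
        (p + 1) / 2 * G' x ^ 2 := by
      have h4 := mul_le_mul_of_nonneg_right hG'' hGx.le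
      have h5 := mul_le_mul_of_nonneg_left hsq (by linarith : 0 ≤ (p + 1) / 2)
      rw [show (p + 1) / 2 * (4 * (G x * (B + β))) = 2 * (p + 1) * (B + β) * G x by ring] at h5
      linarith
    refine (mul_nonneg hfin hP.le).trans_eq ?_
    ring
  have hy : ∀ t ∈ Set.Icc 0 T, HasDerivAt (fun t => G t ^ (-((p - 1) / 2)))
      (-((p - 1) / 2) * q t) t := by
    intro t ht
    refine ((hGd t).rpow_const (p := -((p - 1) / 2)) (Or.inl (hGpos t ht).ne')).congr_deriv ?_
    simp only [hq]
    rw [show -((p - 1) / 2) - 1 = -((p + 1) / 2) by ring]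
    ring
  -- The concave function G^{-(p-1)/2} lies below its tangent at 0 and is still positive at T, which
  -- forces (p-1)/2 G'(0) T < G(0).
  have hmvt := (convex_Icc (0 : ℝ) T).image_sub_le_mul_sub_of_deriv_le
    (f := fun t => G t ^ (-((p - 1) / 2))) (C := -((p - 1) / 2) * q 0)
    (fun t ht => (hy t ht).continuousAt.continuousWithinAt)
    (fun t ht => ((hy t (interior_subset ht)).differentiableAt).differentiableWithinAt)
    (fun t ht => by
      rw [(hy t (interior_subset ht)).deriv]
      have := hqmono t (interior_subset ht)
      nlinarith)
    0 ⟨le_rfl, hT.le⟩ T ⟨hT.le, le_rfl⟩ hT.le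
  have hG0 : G 0 = T * ‖a₀‖ ^ 2 + β * σ ^ 2 := by simp [hG]
  have hG'0 : G' 0 = 2 * β * σ := by simp [hG', primitive_zero]
  have h0pos := hGpos 0 ⟨le_rfl, hT.le⟩
  have hTpos := Real.rpow_pos_of_pos (hGpos T ⟨hT.le, le_rfl⟩) (-((p - 1) / 2))
  have e4 : G 0 ^ (-((p - 1) / 2)) = G 0 * G 0 ^ (-((p + 1) / 2)) := by
    rw [show -((p + 1) / 2) = -((p - 1) / 2) - 1 by ring, Real.rpow_sub_one h0pos.ne']
    field_simp
  have hP : 0 < G 0 ^ (-((p + 1) / 2)) := Real.rpow_pos_of_pos h0pos _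
  have hlt : (p - 1) / 2 * G' 0 * T < G 0 := by
    have : 0 < (G 0 - (p - 1) / 2 * G' 0 * T) * G 0 ^ (-((p + 1) / 2)) := by
      simp only [hq, e4] at hmvt
      nlinarith
    linarith [pos_of_mul_pos_left this hP.le]
  have e5 : (p - 1) * β * σ = 2 * ‖a₀‖ ^ 2 := by
    rw [hσ]; field_simp
  rw [hG0, hG'0] at hlt
  have e6 : T * ‖a₀‖ ^ 2 ≤ β * σ ^ 2 := by nlinarith
  have e7 : β * σ ^ 2 = 4 * p * ‖a₀‖ ^ 2 / ((p - 1) ^ 2 * m) * ‖a₀‖ ^ 2 := by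
    rw [hσ, hβ]; field_simp
    ring
  rw [e7] at e6
  exact le_of_mul_le_mul_right e6 ha

end Hilbert

/-! ### From finite differences in time to an integrated energy inequality -/

section Translation

variable {H : Type*} [NormedAddCommGroup H] [InnerProductSpace ℝ H]

theorem norm_integral_sq_le {W : ℝ → H} (hW : MemLp W 2 volume) {s t : ℝ} (hst : s ≤ t) :
    ‖∫ r in s..t, W r‖ ^ 2 ≤ (t - s) * ∫ r in s..t, ‖W r‖ ^ 2 := by
  have i1 := (intervalIntegrable_of_memLp_two hW s t).norm
  have i3 : IntervalIntegrable (fun s => ‖W s‖ ^ 2) volume s t :=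
    (integrable_norm_sq_of_memLp hW).intervalIntegrable
  have key : ∀ l : ℝ, 0 ≤ (t - s) * (l * l) + (-2 * ∫ r in s..t, ‖W r‖) * l +
      ∫ r in s..t, ‖W r‖ ^ 2 := by
    intro l
    have h0 : 0 ≤ ∫ r in s..t, (‖W r‖ - l) ^ 2 :=
      intervalIntegral.integral_nonneg hst fun _ _ => by positivity
    have h1 : ∫ r in s..t, (‖W r‖ - l) ^ 2 =
        (∫ r in s..t, ‖W r‖ ^ 2) - (2 * l) * (∫ r in s..t, ‖W r‖) + (t - s) * l ^ 2 := by
      rw [← intervalIntegral.integral_const_mul, ← smul_eq_mul (t - s),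
        ← intervalIntegral.integral_const,
        ← intervalIntegral.integral_sub i3 (i1.const_mul _),
        ← intervalIntegral.integral_add (i3.sub (i1.const_mul _)) (by simp)]
      exact intervalIntegral.integral_congr fun s _ => by ring
    linarith
  have := discrim_le_zero key
  rw [discrim] at this
  have h2 : ‖∫ r in s..t, W r‖ ≤ ∫ r in s..t, ‖W r‖ :=
    intervalIntegral.norm_integral_le_integral_norm hst
  have h3 := pow_le_pow_left₀ (norm_nonneg _) h2 2
  linarith

/-- The autocorrelation of a square integrable function is continuous. -/
theorem continuous_integral_inner_translate {W : ℝ → H} (hW : MemLp W 2 volume) (τ : ℝ)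
    (hτ : 0 ≤ τ) : Continuous fun r => ∫ t in (0 : ℝ)..τ, inner ℝ (W (t - r)) (W t) := by
  have hV : MemLp ((Set.Ioc 0 τ).indicator W) 2 volume := hW.indicator measurableSet_Ioc
  have : Fact ((2 : ENNReal) ≠ ⊤) := ⟨by norm_num⟩
  -- The integral is the L² inner product of a translate of W with a fixed truncation of W, so
  -- continuity in r is strong continuity of translations in L².
  have h : (fun r => ∫ t in (0 : ℝ)..τ, inner ℝ (W (t - r)) (W t)) =
      fun r : ℝ => inner ℝ (DomAddAct.mk (-r) +ᵥ hW.toLp W) (hV.toLp _) := by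
    funext r
    rw [L2.inner_def, intervalIntegral.integral_of_le hτ, ← integral_indicator measurableSet_Ioc]
    refine integral_congr_ae ?_
    filter_upwards [DomAddAct.vadd_Lp_ae_eq (DomAddAct.mk (-r)) (hW.toLp W), hV.coeFn_toLp,
      (measurePreserving_vadd (-r) (volume : Measure ℝ)).quasiMeasurePreserving.ae
        hW.coeFn_toLp] with t h1 h2 h3
    rw [h1, h2]
    have : (hW.toLp W) (-r +ᵥ t) = W (t - r) := by
      rw [h3, vadd_eq_add, neg_add_eq_sub]
    simp only [Equiv.symm_apply_apply, this]
    by_cases ht : t ∈ Set.Ioc 0 τ <;> simp [ht]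
  rw [h]
  have hc : Continuous fun r : ℝ => (DomAddAct.mk (-r) : DomAddAct ℝ) :=
    DomAddAct.continuous_mk.comp continuous_neg
  exact (hc.vadd continuous_const).inner continuous_const

/-- Needed for Fubini. Joint measurability of W(t - r), and integrability of its squared norm for r
in (0,h], are read off from convolution integrands with the constant 1 and with an indicator. -/
theorem integrable_inner_translate {W : ℝ → H} (hW : MemLp W 2 volume) (τ h : ℝ) :
    Integrable (fun q : ℝ × ℝ => inner ℝ (W (q.1 - q.2)) (W q.1))
      ((volume.restrict (Set.Ioc 0 τ)).prod (volume.restrict (Set.Ioc 0 h))) := by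
  have hsq := integrable_norm_sq_of_memLp hW
  have hm : AEStronglyMeasurable (fun q : ℝ × ℝ => W (q.1 - q.2))
      (volume.prod volume) := by
    have := AEStronglyMeasurable.convolution_integrand (L := ContinuousLinearMap.lsmul ℝ ℝ)
      (f := fun _ : ℝ => (1 : ℝ)) (g := W) (μ := volume) (ν := volume)
      aestronglyMeasurable_const hW.1
    simpa using this
  have i1 : Integrable (fun q : ℝ × ℝ => ‖W (q.1 - q.2)‖ ^ 2)
      ((volume.restrict (Set.Ioc 0 τ)).prod (volume.restrict (Set.Ioc 0 h))) := by
    have h1 : Integrable ((Set.Ioc 0 h).indicator fun _ => (1 : ℝ)) volume :=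
      (integrable_indicator_iff measurableSet_Ioc).2 (integrableOn_const (by simp))
    have := (h1.convolution_integrand (ContinuousLinearMap.lsmul ℝ ℝ) hsq).restrict
      (s := Set.Ioc 0 τ ×ˢ Set.Ioc 0 h)
    rw [Measure.prod_restrict]
    refine this.congr ?_
    filter_upwards [ae_restrict_mem (measurableSet_Ioc.prod measurableSet_Ioc)] with q hq
    simp [hq.2]
  have i2 : Integrable (fun q : ℝ × ℝ => ‖W q.1‖ ^ 2)
      ((volume.restrict (Set.Ioc 0 τ)).prod (volume.restrict (Set.Ioc 0 h))) :=
    (hsq.restrict (s := Set.Ioc 0 τ)).comp_fst _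
  refine (i1.add i2).mono' ?_ ?_
  · refine AEStronglyMeasurable.inner ?_ ?_
    · rw [Measure.prod_restrict]
      exact hm.restrict
    · exact hW.1.restrict.comp_fst
  · refine Eventually.of_forall fun q => ?_
    refine (norm_inner_le_norm _ _).trans ?_
    simp only [Pi.add_apply]
    nlinarith [sq_nonneg (‖W (q.1 - q.2)‖ - ‖W q.1‖), sq_nonneg (‖W (q.1 - q.2)‖ + ‖W q.1‖)]

/-- The quadratic error is negligible: by Cauchy–Schwarz the integrand is at most ∫_{t-h}^t ‖W‖²,
which tends to 0 for each t and is dominated by the integral over the whole line. -/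
theorem tendsto_integral_norm_sq_primitive_sub {W : ℝ → H} (hW : MemLp W 2 volume) (a₀ : H)
    (τ : ℝ) :
    Tendsto (fun h => ∫ t in (0 : ℝ)..τ, h⁻¹ * ‖primitive a₀ W t - primitive a₀ W (t - h)‖ ^ 2)
      (𝓝[>] 0) (𝓝 0) := by
  have hsq := integrable_norm_sq_of_memLp hW
  have hU := continuous_primitive hW a₀
  have hbd : ∀ t : ℝ, ∀ h > (0 : ℝ), h⁻¹ * ‖primitive a₀ W t - primitive a₀ W (t - h)‖ ^ 2 ≤
      ∫ r in (t - h)..t, ‖W r‖ ^ 2 := by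
    intro t h hh
    rw [primitive_sub hW]
    have := norm_integral_sq_le hW (s := t - h) (t := t) (by linarith)
    rw [inv_mul_le_iff₀ hh]
    rwa [sub_sub_cancel] at this
  suffices h0 : Tendsto
      (fun h => ∫ t in (0 : ℝ)..τ, h⁻¹ * ‖primitive a₀ W t - primitive a₀ W (t - h)‖ ^ 2)
      (𝓝[>] 0) (𝓝 (∫ _ in (0 : ℝ)..τ, (0 : ℝ))) by
    rwa [intervalIntegral.integral_zero] at h0
  refine intervalIntegral.tendsto_integral_filter_of_dominated_convergence
    (fun _ => ∫ r, ‖W r‖ ^ 2) ?_ ?_ intervalIntegrable_const ?_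
  · refine Eventually.of_forall fun h => Continuous.aestronglyMeasurable ?_
    fun_prop
  · filter_upwards [self_mem_nhdsWithin] with h hh
    refine Eventually.of_forall fun t _ => ?_
    have hh' : (0 : ℝ) < h := hh
    rw [Real.norm_of_nonneg (by positivity)]
    refine (hbd t h hh).trans ?_
    rw [intervalIntegral.integral_of_le (by linarith)]
    exact setIntegral_le_integral hsq (Eventually.of_forall fun _ => by positivity)
  · refine Eventually.of_forall fun t _ => ?_
    have hc : Continuous fun x => ∫ r in (0 : ℝ)..x, ‖W r‖ ^ 2 :=
      intervalIntegral.continuous_primitive (fun _ _ => hsq.intervalIntegrable) 0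
    have ht : Tendsto (fun h => ∫ r in (t - h)..t, ‖W r‖ ^ 2) (𝓝[>] 0) (𝓝 0) := by
      have h1 : Continuous fun h => (∫ r in (0 : ℝ)..t, ‖W r‖ ^ 2) -
          ∫ r in (0 : ℝ)..(t - h), ‖W r‖ ^ 2 := by fun_prop
      have h2 := (h1.tendsto 0).mono_left (nhdsWithin_le_nhds (s := Set.Ioi 0))
      simp only [sub_zero, sub_self] at h2
      refine h2.congr fun h => ?_
      rw [intervalIntegral.integral_interval_sub_left hsq.intervalIntegrable
        hsq.intervalIntegrable]
    refine tendsto_of_tendsto_of_tendsto_of_le_of_le' tendsto_const_nhds ht ?_ ?_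
    · filter_upwards [self_mem_nhdsWithin] with h hh
      have hh' : (0 : ℝ) < h := hh
      positivity
    · filter_upwards [self_mem_nhdsWithin] with h hh using hbd t h hh

variable [CompleteSpace H]

/-- Write U(t) - U(t-h) as the integral of W(t - r) over r in (0,h) and exchange the integrals.
Divided by h, the right side tends to the autocorrelation at 0, which is ∫₀^τ ‖W‖². -/
theorem integral_inner_primitive_sub {W : ℝ → H} (hW : MemLp W 2 volume) (a₀ : H) {τ h : ℝ}
    (hτ : 0 ≤ τ) (hh : 0 ≤ h) :
    ∫ t in (0 : ℝ)..τ, inner ℝ (primitive a₀ W t - primitive a₀ W (t - h)) (W t) =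
      ∫ r in (0 : ℝ)..h, ∫ t in (0 : ℝ)..τ, inner ℝ (W (t - r)) (W t) := by
  have hswap := integral_integral_swap
    (f := fun t r => inner ℝ (W (t - r)) (W t)) (integrable_inner_translate hW τ h)
  simp only [intervalIntegral.integral_of_le hτ, intervalIntegral.integral_of_le hh]
  rw [← hswap]
  refine integral_congr_ae (Eventually.of_forall fun t => ?_)
  simp only
  have hsub : primitive a₀ W t - primitive a₀ W (t - h) = ∫ r in (0 : ℝ)..h, W (t - r) := by
    rw [primitive_sub hW, intervalIntegral.integral_comp_sub_left (fun r => W r) t, sub_zero]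
  have hi : IntervalIntegrable (fun r => W (t - r)) volume 0 h := by
    have := (intervalIntegrable_of_memLp_two hW (t - 0) (t - h)).comp_sub_left t
    simpa using this
  rw [hsub, real_inner_comm, intervalIntegral.integral_of_le hh, ← integral_inner]
  · simp only [real_inner_comm]
  · exact (intervalIntegrable_iff_integrableOn_Ioc_of_le hh).1 hi

/-- An energy inequality with finite differences implies the integrated energy inequality. -/
theorem ae_add_integral_norm_sq_le {W : ℝ → H} (hW : MemLp W 2 volume) (a₀ : H) {T J₀ C : ℝ}
    {j : ℝ → ℝ} (hT : 0 < T) (hj : IntegrableOn j (Set.Ioo 0 T)) (hj0 : ∀ t ≤ 0, j t = J₀)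
    {S : Set ℝ} (hS : ∀ᵐ t, t ∈ S)
    (hstep : ∀ s ∈ S, ∀ t ∈ S, s < t → t ∈ Set.Ioo 0 T → j t - j s ≤
      -inner ℝ (primitive a₀ W t - primitive a₀ W s) (W t) +
        C * ‖primitive a₀ W t - primitive a₀ W s‖ ^ 2) :
    ∀ᵐ t, t ∈ Set.Ioo 0 T → j t + ∫ s in (0 : ℝ)..t, ‖W s‖ ^ 2 ≤ J₀ := by
  have hU := continuous_primitive hW a₀
  have hjneg : IntervalIntegrable j volume (-1) 0 :=
    (intervalIntegrable_const (c := J₀)).congr (by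
      intro t ht
      rw [Set.uIoc_of_le (by norm_num)] at ht
      exact (hj0 t ht.2).symm)
  have hjpos : IntervalIntegrable j volume 0 T := by
    rw [intervalIntegrable_iff_integrableOn_Ioc_of_le hT.le]
    exact hj.congr_set_ae Ioo_ae_eq_Ioc.symm
  have hji : IntervalIntegrable j volume (-1) T := hjneg.trans hjpos
  have hsub : ∀ {a b : ℝ}, a ∈ Set.Icc (-1) T → b ∈ Set.Icc (-1) T →
      IntervalIntegrable j volume a b := by
    intro a b ha hb
    refine hji.mono_set ?_
    rw [Set.uIcc_of_le (by linarith : (-1 : ℝ) ≤ T)]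
    exact Set.uIcc_subset_Icc ha hb
  -- No continuity of j is known, so τ is taken among the points where the primitive of j has
  -- derivative j(τ).
  filter_upwards [hji.ae_hasDerivAt_integral] with τ hτd hτ
  have hτ1 : τ ∈ Set.Icc (-1) T := ⟨by linarith [hτ.1], hτ.2.le⟩
  have hd := hτd (by rwa [Set.uIcc_of_le (by linarith)]) (-1) Set.left_mem_uIcc
  have e1 : HasDerivAt (fun h => -∫ t in (-1 : ℝ)..(τ - h), j t) (j τ) 0 := by
    have : HasDerivAt (fun x => ∫ t in (-1 : ℝ)..x, j t) (j τ) (τ - 0) := by simpa using hd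
    simpa using (this.comp_const_sub τ 0).fun_neg
  have l1 := e1.tendsto_slope_zero_right
  set b : ℝ → ℝ := fun r => ∫ t in (0 : ℝ)..τ, inner ℝ (W (t - r)) (W t) with hb
  have hbc : Continuous b := continuous_integral_inner_translate hW τ hτ.1.le
  have e2 : HasDerivAt (fun h => ∫ r in (0 : ℝ)..h, b r) (b 0) 0 :=
    intervalIntegral.integral_hasDerivAt_right (hbc.intervalIntegrable _ _)
      (hbc.stronglyMeasurableAtFilter _ _) hbc.continuousAt
  have l2 := e2.tendsto_slope_zero_right
  have l3 := tendsto_integral_norm_sq_primitive_sub hW a₀ τ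
  have hb0 : b 0 = ∫ s in (0 : ℝ)..τ, ‖W s‖ ^ 2 := by
    simp [hb]
  -- With s = t - h, the differences of j integrate over (0,τ) to the integral of j over (τ-h,τ)
  -- minus that over (-h,0). The latter is h J₀ because j is constant on negative times.
  have hlim := le_of_tendsto_of_tendsto l1 (((l2.neg).add (l3.const_mul C)).add
    (tendsto_const_nhds (x := J₀))) ?_
  · rw [hb0] at hlim
    linarith
  have hmem : Set.Ioo 0 (min 1 τ) ∈ 𝓝[>] (0 : ℝ) :=
    Ioo_mem_nhdsGT (lt_min one_pos hτ.1)
  filter_upwards [hmem] with h hh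
  have hh0 : 0 < h := hh.1
  have hh1 : h < 1 := hh.2.trans_le (min_le_left _ _)
  have hhτ : h < τ := hh.2.trans_le (min_le_right _ _)
  have m0 : (0 : ℝ) ∈ Set.Icc (-1) T := ⟨by norm_num, hT.le⟩
  have mh : -h ∈ Set.Icc (-1) T := ⟨by linarith, by linarith⟩
  have mτ : τ - h ∈ Set.Icc (-1) T := ⟨by linarith, by linarith [hτ.2]⟩
  have m1 : (-1 : ℝ) ∈ Set.Icc (-1) T := ⟨le_rfl, by linarith⟩
  have i1 : IntervalIntegrable (fun t => j (t - h)) volume 0 τ := by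
    have := (hsub mh mτ).comp_sub_right h
    simpa using this
  have i2 : IntervalIntegrable (fun t => ‖primitive a₀ W t - primitive a₀ W (t - h)‖ ^ 2)
      volume 0 τ := by
    apply Continuous.intervalIntegrable
    fun_prop
  have i3 : IntervalIntegrable
      (fun t => inner ℝ (primitive a₀ W t - primitive a₀ W (t - h)) (W t)) volume 0 τ := by
    have i4 := intervalIntegrable_inner_primitive hW a₀ 0 τ
    have hi := intervalIntegrable_of_memLp_two hW 0 τ
    have hc : Continuous fun t => primitive a₀ W t - primitive a₀ W (t - h) := by fun_prop
    obtain ⟨M, hM⟩ := (isCompact_uIcc (a := (0 : ℝ)) (b := τ)).exists_bound_of_continuousOn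
      hc.continuousOn
    refine (hi.norm.const_mul M).mono_fun
      (hc.aestronglyMeasurable.inner (intervalIntegrable_iff.1 hi).aestronglyMeasurable) ?_
    filter_upwards [ae_restrict_mem measurableSet_uIoc] with t ht
    refine (norm_inner_le_norm _ _).trans ?_
    rw [norm_mul, norm_norm]
    gcongr
    exact (hM t (Set.uIoc_subset_uIcc ht)).trans (le_abs_self M)
  have hint : ∫ t in (0 : ℝ)..τ, (j t - j (t - h)) ≤
      ∫ t in (0 : ℝ)..τ, (-inner ℝ (primitive a₀ W t - primitive a₀ W (t - h)) (W t) +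
        C * ‖primitive a₀ W t - primitive a₀ W (t - h)‖ ^ 2) := by
    refine intervalIntegral.integral_mono_ae_restrict hτ.1.le ((hsub m0 hτ1).sub i1)
      ((IntervalIntegrable.neg i3).add (i2.const_mul C)) ?_
    have hShift : ∀ᵐ t, t - h ∈ S :=
      (measurePreserving_sub_right (volume : Measure ℝ) h).quasiMeasurePreserving.ae hS
    rw [← Measure.restrict_congr_set Ioc_ae_eq_Icc]
    filter_upwards [ae_restrict_mem measurableSet_Ioc, ae_restrict_of_ae hS,
      ae_restrict_of_ae hShift] with t ht h1 h2
    exact hstep _ h2 _ h1 (by linarith) ⟨ht.1, ht.2.trans_lt hτ.2⟩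
  have i4 : IntervalIntegrable
      (fun t => -inner ℝ (primitive a₀ W t - primitive a₀ W (t - h)) (W t)) volume 0 τ := i3.neg
  rw [intervalIntegral.integral_sub (hsub m0 hτ1) i1,
    intervalIntegral.integral_add i4 (i2.const_mul C),
    intervalIntegral.integral_const_mul] at hint
  rw [intervalIntegral.integral_neg, integral_inner_primitive_sub hW a₀ hτ.1.le hh0.le,
    intervalIntegral.integral_comp_sub_right (fun t => j t) h, zero_sub] at hint
  have hJ : ∫ t in (-h)..(0 : ℝ), j t = h * J₀ := by
    rw [intervalIntegral.integral_congr (g := fun _ => J₀)]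
    · simp
    · intro t ht
      rw [Set.uIcc_of_le (by linarith)] at ht
      exact hj0 t ht.2
  have a1 := intervalIntegral.integral_add_adjacent_intervals (hsub mh m0) (hsub m0 hτ1)
  have a2 := intervalIntegral.integral_add_adjacent_intervals (hsub mh mτ) (hsub mτ hτ1)
  have a3 := intervalIntegral.integral_add_adjacent_intervals (hsub m1 mτ) (hsub mτ hτ1)
  simp only [zero_add, smul_eq_mul, sub_zero, intervalIntegral.integral_same,
    intervalIntegral.integral_const_mul, sub_neg_eq_add]
  rw [← sub_nonneg]
  have : 0 ≤ h⁻¹ * (h * J₀ - (∫ r in (0 : ℝ)..h, b r) +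
      C * (∫ t in (0 : ℝ)..τ, ‖primitive a₀ W t - primitive a₀ W (t - h)‖ ^ 2) -
      ∫ t in (τ - h)..τ, j t) := by
    refine mul_nonneg (by positivity) ?_
    linarith
  refine this.trans_eq ?_
  rw [← a3]
  field_simp
  ring

end Translation

/-! ### Test functions and approximation in H₀¹ -/

section TestFunctions

variable {n : ℕ} {Ω : Set (E n)} {φ ψ : E n → ℝ}

theorem IsTestFunction.differentiable (h : IsTestFunction Ω φ) : Differentiable ℝ φ :=
  h.1.differentiable (by simp)

theorem norm_gradient_eq (φ : E n → ℝ) (x : E n) : ‖∇ φ x‖ = ‖fderiv ℝ φ x‖ := by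
  simp [gradient]

theorem inner_gradient_left (φ : E n → ℝ) (x y : E n) : inner ℝ (∇ φ x) y = fderiv ℝ φ x y := by
  simp [gradient]

theorem gradient_add' (hφ : Differentiable ℝ φ) (hψ : Differentiable ℝ ψ) :
    ∇ (φ + ψ) = ∇ φ + ∇ ψ := by
  funext x
  simp [gradient, fderiv_add (hφ x) (hψ x)]

theorem gradient_const_smul' (hφ : Differentiable ℝ φ) (c : ℝ) : ∇ (c • φ) = c • ∇ φ := by
  funext x
  simp [gradient, fderiv_const_smul (hφ x)]

theorem IsTestFunction.add (hφ : IsTestFunction Ω φ) (hψ : IsTestFunction Ω ψ) :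
    IsTestFunction Ω (φ + ψ) :=
  ⟨hφ.1.add hψ.1, hφ.2.1.add hψ.2.1,
    (tsupport_add φ ψ).trans (Set.union_subset hφ.2.2 hψ.2.2)⟩

theorem IsTestFunction.const_smul (hφ : IsTestFunction Ω φ) (c : ℝ) :
    IsTestFunction Ω (c • φ) :=
  ⟨hφ.1.const_smul c, hφ.2.1.smul_left (f := fun _ => c),
    (closure_mono (Function.support_const_smul_subset c φ)).trans hφ.2.2⟩

theorem isTestFunction_zero : IsTestFunction Ω (0 : E n → ℝ) :=
  ⟨contDiff_const, HasCompactSupport.zero, by simp [tsupport]⟩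

theorem IsTestFunction.continuous_gradient (hφ : IsTestFunction Ω φ) : Continuous (∇ φ) :=
  (InnerProductSpace.toDual ℝ (E n)).symm.continuous.comp (hφ.1.continuous_fderiv (by simp))

theorem IsTestFunction.hasCompactSupport_gradient (hφ : IsTestFunction Ω φ) :
    HasCompactSupport (∇ φ) :=
  (hφ.2.1.fderiv (𝕜 := ℝ)).comp_left (map_zero _)

theorem IsTestFunction.support_gradient_subset (hφ : IsTestFunction Ω φ) :
    Function.support (∇ φ) ⊆ Ω := by
  refine subset_trans ?_ ((support_fderiv_subset ℝ).trans hφ.2.2)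
  intro x hx h0
  exact hx (by simp [gradient, h0])

theorem IsTestFunction.support_subset (hφ : IsTestFunction Ω φ) : Function.support φ ⊆ Ω :=
  (subset_tsupport φ).trans hφ.2.2

theorem IsTestFunction.memLp (hφ : IsTestFunction Ω φ) (q : ENNReal) : MemLp φ q volume :=
  hφ.1.continuous.memLp_of_hasCompactSupport hφ.2.1

theorem IsTestFunction.memLp_gradient (hφ : IsTestFunction Ω φ) (q : ENNReal) :
    MemLp (∇ φ) q volume :=
  hφ.continuous_gradient.memLp_of_hasCompactSupport hφ.hasCompactSupport_gradient

/-- The elements `(φ, ∇φ)` of `L² × L²` with `φ` a test function. -/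
def testPairs (Ω : Set (E n)) : Submodule ℝ (WithLp 2 (L2 Ω × L2Vec Ω)) where
  carrier := {z | ∃ φ : E n → ℝ, IsTestFunction Ω φ ∧
    z.fst =ᵐ[volume.restrict Ω] φ ∧ z.snd =ᵐ[volume.restrict Ω] ∇ φ}
  add_mem' := by
    rintro z z' ⟨φ, hφ, h1, h2⟩ ⟨φ', hφ', h1', h2'⟩
    refine ⟨φ + φ', hφ.add hφ', ?_, ?_⟩
    · exact (Lp.coeFn_add _ _).trans (h1.add h1')
    · rw [gradient_add' hφ.differentiable hφ'.differentiable]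
      exact (Lp.coeFn_add _ _).trans (h2.add h2')
  zero_mem' := by
    refine ⟨0, isTestFunction_zero, Lp.coeFn_zero _ _ _, ?_⟩
    rw [show ∇ (0 : E n → ℝ) = 0 from funext fun x => by simp [gradient]]
    exact Lp.coeFn_zero _ _ _
  smul_mem' := by
    rintro c z ⟨φ, hφ, h1, h2⟩
    refine ⟨c • φ, hφ.const_smul c, ?_, ?_⟩
    · exact (Lp.coeFn_smul _ _).trans (h1.const_smul c)
    · rw [gradient_const_smul' hφ.differentiable]
      exact (Lp.coeFn_smul _ _).trans (h2.const_smul c)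

/-- The pairs coming from test functions already form a subspace, so the span in `H01` adds nothing
and only the closure matters. -/
theorem mem_H01_iff {z : WithLp 2 (L2 Ω × L2Vec Ω)} :
    z ∈ H01 Ω ↔ z ∈ closure (testPairs Ω : Set (WithLp 2 (L2 Ω × L2Vec Ω))) := by
  have : Submodule.span ℝ {z : WithLp 2 (L2 Ω × L2Vec Ω) | ∃ φ : E n → ℝ, IsTestFunction Ω φ ∧
      z.fst =ᵐ[volume.restrict Ω] φ ∧ z.snd =ᵐ[volume.restrict Ω] ∇ φ} = testPairs Ω :=
    Submodule.span_eq (testPairs Ω)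
  rw [H01, this, ← SetLike.mem_coe, Submodule.topologicalClosure_coe]

/-- Every element of `H₀¹` is a limit of test functions, a.e. and in norm. -/
theorem exists_seq_test (v : H01 Ω) : ∃ (φ : ℕ → E n → ℝ) (z : ℕ → WithLp 2 (L2 Ω × L2Vec Ω)),
    (∀ k, IsTestFunction Ω (φ k)) ∧ (∀ k, (z k).snd =ᵐ[volume.restrict Ω] ∇ (φ k)) ∧
    (∀ᵐ x ∂(volume.restrict Ω), Tendsto (fun k => φ k x) atTop (𝓝 (fn v x))) ∧
    Tendsto (fun k => (z k).snd) atTop (𝓝 (grad v)) := by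
  obtain ⟨z, hz, hlim⟩ := mem_closure_iff_seq_limit.1 (mem_H01_iff.1 v.2)
  choose φ hφ h1 h2 using hz
  have hf : Tendsto (fun k => (z k).fst) atTop (𝓝 (fn v)) :=
    ((WithLp.fstL 2 ℝ _ _).continuous.tendsto _).comp hlim
  have hg : Tendsto (fun k => (z k).snd) atTop (𝓝 (grad v)) :=
    ((WithLp.sndL 2 ℝ _ _).continuous.tendsto _).comp hlim
  obtain ⟨ns, hns, hae⟩ := (tendstoInMeasure_of_tendsto_Lp hf).exists_seq_tendsto_ae
  refine ⟨fun k => φ (ns k), fun k => z (ns k), fun k => hφ _, fun k => h2 _, ?_,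
    hg.comp hns.tendsto_atTop⟩
  filter_upwards [hae, ae_all_iff.2 h1] with x hx h1x
  exact hx.congr fun k => h1x _

/-- An inequality `‖m φ‖_q ≤ C ‖∇φ‖₂` for test functions extends to `H₀¹`. -/
theorem eLpNorm_mul_fn_le {m : E n → ℝ} (hm : Measurable m) {q C : ENNReal} (hC : C ≠ ⊤)
    (h : ∀ φ, IsTestFunction Ω φ → eLpNorm (fun x => m x * φ x) q (volume.restrict Ω) ≤
      C * eLpNorm (∇ φ) 2 (volume.restrict Ω)) (v : H01 Ω) :
    eLpNorm (fun x => m x * fn v x) q (volume.restrict Ω) ≤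
      C * eLpNorm (grad v) 2 (volume.restrict Ω) := by
  obtain ⟨φ, z, hφ, hz, hae, hlim⟩ := exists_seq_test v
  -- Fatou on the left along an a.e. convergent sequence of test functions; on the right the
  -- gradients converge in L².
  have h1 := Lp.eLpNorm_lim_le_liminf_eLpNorm (p := q) (μ := volume.restrict Ω)
    (f := fun k x => m x * φ k x)
    (fun k => (hm.mul (hφ k).1.continuous.measurable).aestronglyMeasurable)
    (fun x => m x * fn v x) (by
      filter_upwards [hae] with x hx using hx.const_mul _)
  refine h1.trans ?_
  have h2 : Tendsto (fun k => C * ‖(z k).snd‖ₑ) atTop (𝓝 (C * ‖grad v‖ₑ)) :=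
    ENNReal.Tendsto.const_mul (hlim.enorm) (Or.inr hC)
  rw [← Lp.enorm_def, ← h2.liminf_eq]
  refine liminf_le_liminf (Eventually.of_forall fun k => ?_)
  rw [Lp.enorm_def, eLpNorm_congr_ae (hz k)]
  exact h _ (hφ k)

end TestFunctions

/-! ### The Sobolev inequality in H₀¹ -/

section Sobolev

variable {n : ℕ} {Ω : Set (E n)}

/-- The Sobolev exponent `2* = 2n/(n-2)`. -/
noncomputable def sobolevExp (n : ℕ) : ℝ := 2 * n / (n - 2)

/-- Test functions in Ω are compactly supported on the whole space, where the
Gagliardo–Nirenberg–Sobolev inequality applies; density does the rest. -/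
theorem exists_sobolev_const (hn : 3 ≤ n) (Ω : Set (E n)) : ∃ C : NNReal, ∀ v : H01 Ω,
    eLpNorm (fn v) (ENNReal.ofReal (sobolevExp n)) (volume.restrict Ω) ≤
      C * eLpNorm (grad v) 2 (volume.restrict Ω) := by
  have hn' : (3 : ℝ) ≤ n := by exact_mod_cast hn
  refine ⟨eLpNormLESNormFDerivOfEqInnerConst (volume : Measure (E n)) 2, fun v => ?_⟩
  have := eLpNorm_mul_fn_le (m := fun _ => 1) measurable_const
    (q := ENNReal.ofReal (sobolevExp n)) (ENNReal.coe_ne_top (r :=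
      eLpNormLESNormFDerivOfEqInnerConst (volume : Measure (E n)) 2)) (fun φ hφ => ?_) v
  · simpa using this
  · have h1 := eLpNorm_le_eLpNorm_fderiv_of_eq_inner (volume : Measure (E n)) (u := φ)
      (hφ.1.of_le (by simp)) hφ.2.1 (p := 2) (p' := (sobolevExp n).toNNReal) (by norm_num)
      (by simp; omega) (by
        rw [Real.coe_toNNReal _ (by unfold sobolevExp; apply div_nonneg <;> linarith)]
        simp [sobolevExp]
        field_simp)
    simp only [one_mul]
    refine (eLpNorm_restrict_le _ _ _ _).trans (h1.trans ?_)
    rw [eLpNorm_restrict_eq_of_support_subset hφ.support_gradient_subset]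
    refine le_of_eq ?_
    congr 1
    exact eLpNorm_congr_norm_ae (Eventually.of_forall fun x => (norm_gradient_eq φ x).symm)

end Sobolev

/-! ### Hardy's inequality with its constant -/

section Hardy

variable {n : ℕ} {Ω : Set (E n)} {φ : E n → ℝ}

theorem hasFDerivAt_inv_norm_sq_add {ε : ℝ} (hε : 0 < ε) (x : E n) :
    HasFDerivAt (fun x : E n => (‖x‖ ^ 2 + ε)⁻¹)
      (-((‖x‖ ^ 2 + ε) ^ 2)⁻¹ • (2 • innerSL ℝ x)) x := by
  have h1 : HasFDerivAt (fun x : E n => ‖x‖ ^ 2 + ε) (2 • innerSL ℝ x) x := by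
    simpa using ((hasFDerivAt_id x).norm_sq).add_const ε
  have h2 := (hasDerivAt_inv (show ‖x‖ ^ 2 + ε ≠ 0 by positivity)).comp_hasFDerivAt x h1
  exact h2

/-- Integration by parts against the regularisation `x / (|x|² + ε)` of `x / |x|²`. -/
theorem integral_sq_mul_div_eq (hφ : IsTestFunction Ω φ) {ε : ℝ} (hε : 0 < ε) :
    ∫ x, φ x ^ 2 * (n * (‖x‖ ^ 2 + ε)⁻¹ - 2 * ‖x‖ ^ 2 * ((‖x‖ ^ 2 + ε) ^ 2)⁻¹) =
      -∫ x, 2 * φ x * inner ℝ (∇ φ x) x * (‖x‖ ^ 2 + ε)⁻¹ := by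
  have hpos : ∀ x : E n, ‖x‖ ^ 2 + ε ≠ 0 := fun x => by positivity
  have hd := hφ.differentiable
  have hc := hφ.1.continuous
  have hcf : Continuous (fderiv ℝ φ) := hφ.1.continuous_fderiv (by simp)
  set e : Fin n → E n := fun i => EuclideanSpace.single i 1 with he
  have hF : ∀ i x, HasFDerivAt (fun x : E n => x i * (‖x‖ ^ 2 + ε)⁻¹)
      (x i • (-((‖x‖ ^ 2 + ε) ^ 2)⁻¹ • (2 • innerSL ℝ x)) +
        (‖x‖ ^ 2 + ε)⁻¹ • (EuclideanSpace.proj i : E n →L[ℝ] ℝ)) x := fun i x =>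
    ((EuclideanSpace.proj i : E n →L[ℝ] ℝ).hasFDerivAt).mul (hasFDerivAt_inv_norm_sq_add hε x)
  have hFe : ∀ i x, fderiv ℝ (fun x : E n => x i * (‖x‖ ^ 2 + ε)⁻¹) x (e i) =
      (‖x‖ ^ 2 + ε)⁻¹ - 2 * (x i) ^ 2 * ((‖x‖ ^ 2 + ε) ^ 2)⁻¹ := by
    intro i x
    rw [(hF i x).fderiv]
    simp [he, EuclideanSpace.inner_single_right]
    ring
  have hS : ∀ i x, fderiv ℝ (fun x => φ x ^ 2) x (e i) = 2 * φ x * fderiv ℝ φ x (e i) := by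
    intro i x
    rw [((hd x).hasFDerivAt.pow 2).fderiv]
    simp
  have cpt : ∀ g : E n → ℝ, Continuous g → Integrable (fun x => φ x * g x) := fun g hg =>
    (hc.mul hg).integrable_of_hasCompactSupport hφ.2.1.mul_right
  have hci : Continuous fun x : E n => (‖x‖ ^ 2 + ε)⁻¹ :=
    (by fun_prop : Continuous fun x : E n => ‖x‖ ^ 2 + ε).inv₀ hpos
  have hci2 : Continuous fun x : E n => ((‖x‖ ^ 2 + ε) ^ 2)⁻¹ :=
    (by fun_prop : Continuous fun x : E n => (‖x‖ ^ 2 + ε) ^ 2).inv₀ fun x => by positivity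
  have I1 : ∀ i, Integrable fun x : E n =>
      φ x ^ 2 * ((‖x‖ ^ 2 + ε)⁻¹ - 2 * (x i) ^ 2 * ((‖x‖ ^ 2 + ε) ^ 2)⁻¹) := by
    intro i
    refine (cpt (fun x => φ x * ((‖x‖ ^ 2 + ε)⁻¹ - 2 * (x i) ^ 2 * ((‖x‖ ^ 2 + ε) ^ 2)⁻¹))
      (by fun_prop)).congr (Eventually.of_forall fun x => ?_)
    simp only
    ring
  have I2 : ∀ i, Integrable fun x : E n =>
      2 * φ x * fderiv ℝ φ x (e i) * (x i * (‖x‖ ^ 2 + ε)⁻¹) := by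
    intro i
    refine (cpt (fun x => 2 * fderiv ℝ φ x (e i) * (x i * (‖x‖ ^ 2 + ε)⁻¹))
      (by fun_prop)).congr (Eventually.of_forall fun x => ?_)
    simp only
    ring
  have I3 : ∀ i, Integrable fun x : E n => φ x ^ 2 * (x i * (‖x‖ ^ 2 + ε)⁻¹) := by
    intro i
    refine (cpt (fun x => φ x * (x i * (‖x‖ ^ 2 + ε)⁻¹))
      (by fun_prop)).congr (Eventually.of_forall fun x => ?_)
    simp only
    ring
  have key : ∀ i, ∫ x : E n,
      φ x ^ 2 * ((‖x‖ ^ 2 + ε)⁻¹ - 2 * (x i) ^ 2 * ((‖x‖ ^ 2 + ε) ^ 2)⁻¹) =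
      -∫ x : E n, 2 * φ x * fderiv ℝ φ x (e i) * (x i * (‖x‖ ^ 2 + ε)⁻¹) := by
    intro i
    have := integral_mul_fderiv_eq_neg_fderiv_mul_of_integrable (μ := (volume : Measure (E n)))
      (f := fun x => φ x ^ 2) (g := fun x : E n => x i * (‖x‖ ^ 2 + ε)⁻¹) (v := e i)
      (by simpa only [hS] using I2 i) (by simpa only [hFe] using I1 i) (I3 i)
      (fun x _ => (hd x).pow 2) (fun x _ => (hF i x).differentiableAt)
    simpa only [hS, hFe] using this
  have hsum := Finset.sum_congr rfl fun i (_ : i ∈ Finset.univ) => key i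
  rw [← integral_finsetSum _ fun i _ => I1 i, Finset.sum_neg_distrib,
    ← integral_finsetSum _ fun i _ => I2 i] at hsum
  refine Eq.trans (integral_congr_ae (Eventually.of_forall fun x => ?_)) (hsum.trans (congrArg _
    (integral_congr_ae (Eventually.of_forall fun x => ?_))))
  · simp only
    rw [← Finset.mul_sum, Finset.sum_sub_distrib, ← Finset.sum_mul, ← Finset.mul_sum,
      EuclideanSpace.real_norm_sq_eq]
    simp
  · have hx : inner ℝ (∇ φ x) x = ∑ i, fderiv ℝ φ x (e i) * x i := by
      rw [inner_gradient_left]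
      have hsx : x = ∑ i, x i • e i := by
        conv_lhs => rw [← (EuclideanSpace.basisFun (Fin n) ℝ).sum_repr x]
        simp [he]
      have hfx : ∀ L : E n →L[ℝ] ℝ, L x = ∑ i, L (e i) * x i := fun L => by
        conv_lhs => rw [hsx, map_sum]
        simp [mul_comm]
      exact hfx _
    simp only
    rw [hx, Finset.mul_sum, Finset.sum_mul]
    refine Finset.sum_congr rfl fun i _ => ?_
    ring

/-- The field x/(|x|²+ε) has divergence at least (n-2)/(|x|²+ε) = 2l/(|x|²+ε). After integration by
parts, Young's inequality with weight l absorbs half of the left side and leaves the constant l⁻² =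
H_n, uniformly in ε. -/
theorem integral_sq_mul_inv_le (hn : 3 ≤ n) (hφ : IsTestFunction Ω φ) {ε : ℝ} (hε : 0 < ε) :
    ∫ x, φ x ^ 2 * (‖x‖ ^ 2 + ε)⁻¹ ≤ hardyConst n * ∫ x, ‖∇ φ x‖ ^ 2 := by
  have hn' : (3 : ℝ) ≤ n := by exact_mod_cast hn
  have hc := hφ.1.continuous
  have hcg := hφ.continuous_gradient
  have cpt : ∀ g : E n → ℝ, Continuous g → Integrable (fun x => φ x * g x) := fun g hg =>
    (hc.mul hg).integrable_of_hasCompactSupport hφ.2.1.mul_right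
  have hci : Continuous fun x : E n => (‖x‖ ^ 2 + ε)⁻¹ :=
    (by fun_prop : Continuous fun x : E n => ‖x‖ ^ 2 + ε).inv₀ fun x => by positivity
  have hci2 : Continuous fun x : E n => ((‖x‖ ^ 2 + ε) ^ 2)⁻¹ :=
    (by fun_prop : Continuous fun x : E n => (‖x‖ ^ 2 + ε) ^ 2).inv₀ fun x => by positivity
  have I1 : Integrable fun x : E n => φ x ^ 2 * (‖x‖ ^ 2 + ε)⁻¹ := by
    refine (cpt (fun x => φ x * (‖x‖ ^ 2 + ε)⁻¹) (by fun_prop)).congr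
      (Eventually.of_forall fun x => ?_)
    simp only
    ring
  have I2 : Integrable fun x : E n => ‖∇ φ x‖ ^ 2 := by
    simpa using (hφ.memLp_gradient 2).integrable_norm_pow (by norm_num)
  have I3 : Integrable fun x : E n => φ x ^ 2 *
      (n * (‖x‖ ^ 2 + ε)⁻¹ - 2 * ‖x‖ ^ 2 * ((‖x‖ ^ 2 + ε) ^ 2)⁻¹) := by
    refine (cpt (fun x => φ x * (n * (‖x‖ ^ 2 + ε)⁻¹ -
      2 * ‖x‖ ^ 2 * ((‖x‖ ^ 2 + ε) ^ 2)⁻¹)) (by fun_prop)).congr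
      (Eventually.of_forall fun x => ?_)
    simp only
    ring
  have I4 : Integrable fun x : E n => 2 * φ x * inner ℝ (∇ φ x) x * (‖x‖ ^ 2 + ε)⁻¹ := by
    refine (cpt (fun x => 2 * inner ℝ (∇ φ x) x * (‖x‖ ^ 2 + ε)⁻¹) (by fun_prop)).congr
      (Eventually.of_forall fun x => ?_)
    simp only
    ring
  set l : ℝ := (n - 2) / 2 with hl
  have hl0 : 0 < l := by rw [hl]; linarith
  have h1 : (n - 2) * ∫ x, φ x ^ 2 * (‖x‖ ^ 2 + ε)⁻¹ ≤
      ∫ x, φ x ^ 2 * (n * (‖x‖ ^ 2 + ε)⁻¹ - 2 * ‖x‖ ^ 2 * ((‖x‖ ^ 2 + ε) ^ 2)⁻¹) := by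
    rw [← integral_const_mul]
    refine integral_mono (I1.const_mul _) I3 fun x => ?_
    have hx : 0 < ‖x‖ ^ 2 + ε := by positivity
    have : ‖x‖ ^ 2 * ((‖x‖ ^ 2 + ε) ^ 2)⁻¹ ≤ (‖x‖ ^ 2 + ε)⁻¹ := by
      rw [← div_eq_mul_inv, div_le_iff₀ (by positivity), sq (‖x‖ ^ 2 + ε),
        inv_mul_cancel_left₀ hx.ne']
      linarith
    have h2 := mul_le_mul_of_nonneg_left this (sq_nonneg (φ x))
    simp only
    nlinarith
  have h2 : -∫ x, 2 * φ x * inner ℝ (∇ φ x) x * (‖x‖ ^ 2 + ε)⁻¹ ≤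
      l * (∫ x, φ x ^ 2 * (‖x‖ ^ 2 + ε)⁻¹) + l⁻¹ * ∫ x, ‖∇ φ x‖ ^ 2 := by
    rw [← integral_neg, ← integral_const_mul, ← integral_const_mul,
      ← integral_add (I1.const_mul _) (I2.const_mul _)]
    refine integral_mono I4.neg ((I1.const_mul _).add (I2.const_mul _)) fun x => ?_
    have hx : 0 < ‖x‖ ^ 2 + ε := by positivity
    simp only
    set a := φ x
    set g := (‖x‖ ^ 2 + ε)⁻¹ with hg
    set c := inner ℝ (∇ φ x) x with hcdef
    have hg0 : 0 < g := by positivity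
    have hcb : c ^ 2 ≤ ‖∇ φ x‖ ^ 2 * ‖x‖ ^ 2 := by
      rw [← mul_pow, ← sq_abs c]
      exact pow_le_pow_left₀ (abs_nonneg _) (abs_real_inner_le_norm _ _) 2
    have hxg : ‖x‖ ^ 2 * g ≤ 1 := by
      rw [hg, ← div_eq_mul_inv, div_le_one hx]
      linarith
    have h3 : c ^ 2 * g ≤ ‖∇ φ x‖ ^ 2 := by
      calc c ^ 2 * g ≤ ‖∇ φ x‖ ^ 2 * ‖x‖ ^ 2 * g := by gcongr
        _ = ‖∇ φ x‖ ^ 2 * (‖x‖ ^ 2 * g) := by ring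
        _ ≤ ‖∇ φ x‖ ^ 2 * 1 := by gcongr
        _ = _ := mul_one _
    have h4 : 0 ≤ l⁻¹ * (l * a + c) ^ 2 * g := by positivity
    have h5 : l⁻¹ * (l * a + c) ^ 2 * g = l * (a ^ 2 * g) + 2 * a * c * g + l⁻¹ * (c ^ 2 * g) := by
      field_simp
      ring
    have h6 := mul_le_mul_of_nonneg_left h3 (inv_pos.2 hl0).le
    linarith
  rw [← integral_sq_mul_div_eq hφ hε] at h2
  have h3 : l * (∫ x, φ x ^ 2 * (‖x‖ ^ 2 + ε)⁻¹) ≤ l⁻¹ * ∫ x, ‖∇ φ x‖ ^ 2 := by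
    have : (n - 2 : ℝ) = l + l := by rw [hl]; ring
    rw [this, add_mul] at h1
    linarith
  rw [← le_inv_mul_iff₀ hl0] at h3
  refine h3.trans_eq ?_
  have hn2 : (n : ℝ) - 2 ≠ 0 := by linarith
  rw [← mul_assoc, hardyConst, hl]
  congr 1
  field_simp
  norm_num

theorem hardyConst_pos (hn : 3 ≤ n) : 0 < hardyConst n := by
  have hn' : (3 : ℝ) ≤ n := by exact_mod_cast hn
  have : (0 : ℝ) < n - 2 := by linarith
  unfold hardyConst
  positivity

theorem eLpNorm_inv_norm_mul_test_le (hn : 3 ≤ n) (hφ : IsTestFunction Ω φ) :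
    eLpNorm (fun x => ‖x‖⁻¹ * φ x) 2 (volume.restrict Ω) ≤
      ENNReal.ofReal (√(hardyConst n)) * eLpNorm (∇ φ) 2 (volume.restrict Ω) := by
  have : Nontrivial (E n) := by
    have : Nonempty (Fin n) := ⟨⟨0, by omega⟩⟩
    infer_instance
  refine (eLpNorm_restrict_le _ _ _ _).trans ?_
  rw [eLpNorm_restrict_eq_of_support_subset hφ.support_gradient_subset]
  have hH := (hardyConst_pos hn).le
  set ε : ℕ → ℝ := fun k => 1 / ((k : ℝ) + 1) with hεdef
  have hε : ∀ k, 0 < ε k := fun k => by simp only [hεdef]; positivity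
  have hεlim : Tendsto ε atTop (𝓝 0) := tendsto_one_div_add_atTop_nhds_zero_nat
  have hcont : ∀ k, Continuous fun x => φ x * (√(‖x‖ ^ 2 + ε k))⁻¹ := fun k =>
    hφ.1.continuous.mul ((by fun_prop : Continuous fun x : E n => √(‖x‖ ^ 2 + ε k)).inv₀
      fun x => (Real.sqrt_pos.2 (by have := hε k; positivity)).ne')
  have h1 := Lp.eLpNorm_lim_le_liminf_eLpNorm (p := 2) (μ := (volume : Measure (E n)))
    (f := fun k x => φ x * (√(‖x‖ ^ 2 + ε k))⁻¹)
    (fun k => (hcont k).aestronglyMeasurable) (fun x => ‖x‖⁻¹ * φ x) (by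
      filter_upwards [compl_mem_ae_iff.2 (measure_singleton (0 : E n))] with x hx
      have hx0 : ‖x‖ ≠ 0 := norm_ne_zero_iff.2 hx
      have h2 : Tendsto (fun k => √(‖x‖ ^ 2 + ε k)) atTop (𝓝 (√(‖x‖ ^ 2 + 0))) :=
        ((Real.continuous_sqrt.tendsto _).comp (tendsto_const_nhds.add hεlim))
      rw [add_zero, Real.sqrt_sq (norm_nonneg x)] at h2
      simpa [mul_comm] using (h2.inv₀ hx0).const_mul (φ x))
  refine h1.trans ?_
  -- The bound holds for every k, so any eventual lower bound of the sequence is below it.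
  refine liminf_le_of_le (by isBoundedDefault) fun b hb => ?_
  obtain ⟨k, hk⟩ := hb.exists
  refine hk.trans ?_
  have hm : MemLp (fun x => φ x * (√(‖x‖ ^ 2 + ε k))⁻¹) 2 volume :=
    (hcont k).memLp_of_hasCompactSupport hφ.2.1.mul_right
  rw [hm.eLpNorm_eq_integral_rpow_norm (by norm_num) (by norm_num),
    (hφ.memLp_gradient 2).eLpNorm_eq_integral_rpow_norm (by norm_num) (by norm_num),
    ← ENNReal.ofReal_mul (Real.sqrt_nonneg _)]
  refine ENNReal.ofReal_le_ofReal ?_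
  simp only [ENNReal.toReal_ofNat, Real.rpow_two]
  rw [← one_div, ← Real.sqrt_eq_rpow, ← Real.sqrt_eq_rpow, ← Real.sqrt_mul hH]
  refine Real.sqrt_le_sqrt ?_
  refine le_trans (le_of_eq ?_) (integral_sq_mul_inv_le hn hφ (hε k))
  refine integral_congr_ae (Eventually.of_forall fun x => ?_)
  have := hε k
  simp only [Real.norm_eq_abs, sq_abs, mul_pow, inv_pow]
  rw [Real.sq_sqrt (by positivity)]

/-- Hardy's inequality in `H₀¹`. -/
theorem eLpNorm_inv_norm_mul_fn_le (hn : 3 ≤ n) (v : H01 Ω) :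
    eLpNorm (fun x => ‖x‖⁻¹ * fn v x) 2 (volume.restrict Ω) ≤
      ENNReal.ofReal (√(hardyConst n)) * eLpNorm (grad v) 2 (volume.restrict Ω) :=
  eLpNorm_mul_fn_le measurable_norm.inv ENNReal.ofReal_ne_top
    (fun _ hφ => eLpNorm_inv_norm_mul_test_le hn hφ) v

end Hardy

/-! ### The map v ↦ v/|x| from H₀¹ to L² -/

section Weighted

variable {n : ℕ} {Ω : Set (E n)}

theorem fn_sub (v w : H01 Ω) : fn (v - w) = fn v - fn w := rfl

theorem grad_sub (v w : H01 Ω) : grad (v - w) = grad v - grad w := rfl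

theorem norm_grad_le (v : H01 Ω) : ‖grad v‖ ≤ ‖v‖ := by
  have h := WithLp.prod_norm_sq_eq_of_L2 (v : WithLp 2 (L2 Ω × L2Vec Ω))
  have h2 : ‖v‖ ^ 2 = ‖fn v‖ ^ 2 + ‖grad v‖ ^ 2 := h
  exact (sq_le_sq₀ (norm_nonneg _) (norm_nonneg _)).1 (by nlinarith [sq_nonneg ‖fn v‖])

theorem integral_norm_sq_eq {V : Type*} [NormedAddCommGroup V] [InnerProductSpace ℝ V]
    (f : Lp V 2 (volume.restrict Ω)) : ∫ x in Ω, ‖f x‖ ^ 2 = ‖f‖ ^ 2 := by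
  rw [← real_inner_self_eq_norm_sq f, L2.inner_def]
  simp only [real_inner_self_eq_norm_sq]

theorem ae_ne_zero (hn : 3 ≤ n) : ∀ᵐ x ∂(volume.restrict Ω), x ≠ 0 := by
  have : Nontrivial (E n) := by
    have : Nonempty (Fin n) := ⟨⟨0, by omega⟩⟩
    infer_instance
  exact ae_restrict_of_ae (compl_mem_ae_iff.2 (measure_singleton (0 : E n)))

theorem memLp_weighted (hn : 3 ≤ n) (v : H01 Ω) :
    MemLp (fun x => ‖x‖⁻¹ * fn v x) 2 (volume.restrict Ω) := by
  refine ⟨(measurable_norm.inv.aestronglyMeasurable).mul (Lp.aestronglyMeasurable _), ?_⟩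
  exact (eLpNorm_inv_norm_mul_fn_le hn v).trans_lt
    (ENNReal.mul_lt_top ENNReal.ofReal_lt_top (Lp.memLp (grad v)).2)

/-- The function `v / |x| ∈ L²(Ω)` for `v ∈ H₀¹(Ω)`. -/
noncomputable def weighted (hn : 3 ≤ n) (v : H01 Ω) : L2 Ω := (memLp_weighted hn v).toLp _

theorem coeFn_weighted (hn : 3 ≤ n) (v : H01 Ω) :
    weighted hn v =ᵐ[volume.restrict Ω] fun x => ‖x‖⁻¹ * fn v x :=
  (memLp_weighted hn v).coeFn_toLp

theorem weighted_sub (hn : 3 ≤ n) (v w : H01 Ω) :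
    weighted hn (v - w) = weighted hn v - weighted hn w := by
  refine Lp.ext ?_
  rw [weighted, weighted, weighted, ← MemLp.toLp_sub]
  refine (MemLp.coeFn_toLp _).trans (EventuallyEq.trans ?_ (MemLp.coeFn_toLp _).symm)
  filter_upwards [Lp.coeFn_sub (fn v) (fn w)] with x hx
  rw [fn_sub, hx]
  simp [mul_sub]

theorem norm_weighted_sq (hn : 3 ≤ n) (v : H01 Ω) : ‖weighted hn v‖ ^ 2 = weightedNormSq v := by
  rw [← integral_norm_sq_eq, weightedNormSq]
  refine integral_congr_ae ?_
  filter_upwards [coeFn_weighted hn v] with x hx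
  rw [hx, norm_mul, norm_inv, norm_norm, Real.norm_eq_abs, div_eq_inv_mul]

theorem norm_weighted_sq_le (hn : 3 ≤ n) (v : H01 Ω) :
    ‖weighted hn v‖ ^ 2 ≤ hardyConst n * ‖grad v‖ ^ 2 := by
  have h := eLpNorm_inv_norm_mul_fn_le hn v
  have h1 : ‖weighted hn v‖ ≤ √(hardyConst n) * ‖grad v‖ := by
    rw [weighted, Lp.norm_toLp, Lp.norm_def, ← ENNReal.toReal_ofReal (Real.sqrt_nonneg _),
      ← ENNReal.toReal_mul]
    exact ENNReal.toReal_mono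
      (ENNReal.mul_lt_top ENNReal.ofReal_lt_top (Lp.memLp (grad v)).2).ne h
  calc ‖weighted hn v‖ ^ 2 ≤ (√(hardyConst n) * ‖grad v‖) ^ 2 := by gcongr
    _ = _ := by rw [mul_pow, Real.sq_sqrt (hardyConst_pos hn).le]

/-- Multiplication by `|x|` on `L²(Ω)`, for bounded `Ω`. -/
theorem exists_normMul (hn : 3 ≤ n) (hb : Bornology.IsBounded Ω) (hm : MeasurableSet Ω) :
    ∃ D : L2 Ω →L[ℝ] L2 Ω, (∀ f, D f =ᵐ[volume.restrict Ω] fun x => ‖x‖ * f x) ∧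
      Function.Injective D := by
  obtain ⟨R, hR⟩ := hb.exists_norm_le
  have hmem : MemLp (fun x : E n => ‖x‖) ⊤ (volume.restrict Ω) :=
    memLp_top_of_bound continuous_norm.aestronglyMeasurable R (by
      filter_upwards [ae_restrict_mem hm] with x hx
      simpa using hR x hx)
  have hD : ∀ f, (ContinuousLinearMap.mul ℝ ℝ).holderL (volume.restrict Ω) ⊤ 2 2 (hmem.toLp _) f
      =ᵐ[volume.restrict Ω] fun x => ‖x‖ * f x := by
    intro f
    have := (ContinuousLinearMap.mul ℝ ℝ).coeFn_holder (r := 2) (hmem.toLp _) f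
    refine EventuallyEq.trans this ?_
    filter_upwards [hmem.coeFn_toLp] with x hx
    rw [hx]
    rfl
  refine ⟨_, hD, ?_⟩
  rw [injective_iff_map_eq_zero]
  intro f hf
  refine Lp.ext ?_
  have h1 := hD f
  rw [hf] at h1
  filter_upwards [h1, Lp.coeFn_zero ℝ 2 (volume.restrict Ω), ae_ne_zero hn] with x h1 h2 h3
  rw [h2] at h1 ⊢
  simpa [h3] using h1.symm

theorem normMul_weighted (hn : 3 ≤ n) {D : L2 Ω →L[ℝ] L2 Ω}
    (hD : ∀ f, D f =ᵐ[volume.restrict Ω] fun x => ‖x‖ * f x) (v : H01 Ω) :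
    D (weighted hn v) = fn v := by
  refine Lp.ext ?_
  filter_upwards [hD (weighted hn v), coeFn_weighted hn v, ae_ne_zero hn] with x h1 h2 h3
  rw [h1, h2, mul_inv_cancel_left₀ (norm_ne_zero_iff.2 h3)]

end Weighted

/-! ### Pointwise inequalities for powers -/

section Pointwise

/-- The derivative p|x|^{p-1} is at most p A^{p-1}. On each half-line this is the mean value
inequality; for opposite signs one passes through 0. -/
theorem abs_rpow_mul_self_sub_le {p A x y : ℝ} (hp : 1 < p) (hx : |x| ≤ A) (hy : |y| ≤ A) :
    |(|x| ^ (p - 1) * x) - |y| ^ (p - 1) * y| ≤ p * A ^ (p - 1) * |x - y| := by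
  have hA : 0 ≤ A := (abs_nonneg x).trans hx
  have base : ∀ a ∈ Set.Icc 0 A, ∀ b ∈ Set.Icc 0 A,
      |b ^ p - a ^ p| ≤ p * A ^ (p - 1) * |b - a| := by
    intro a ha b hb
    refine (convex_Icc 0 A).norm_image_sub_le_of_norm_hasDerivWithin_le (f := fun t => t ^ p)
      (f' := fun t => p * t ^ (p - 1)) (fun t ht =>
        (Real.hasDerivAt_rpow_const (Or.inr hp.le)).hasDerivWithinAt) (fun t ht => ?_) ha hb
    have := Real.rpow_nonneg ht.1 (p - 1)
    rw [Real.norm_of_nonneg (by positivity)]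
    have := Real.rpow_le_rpow ht.1 ht.2 (by linarith : 0 ≤ p - 1)
    gcongr
  have hpos : ∀ t : ℝ, 0 ≤ t → |t| ^ (p - 1) * t = t ^ p := by
    intro t ht
    rw [abs_of_nonneg ht]
    rcases ht.eq_or_lt with rfl | ht
    · simp [Real.zero_rpow (by linarith : p ≠ 0)]
    · rw [Real.rpow_sub_one ht.ne']
      field_simp
  have hneg : ∀ t : ℝ, t ≤ 0 → |t| ^ (p - 1) * t = -(-t) ^ p := by
    intro t ht
    rw [← hpos (-t) (by linarith), abs_neg]
    ring
  have h0 : (0 : ℝ) ∈ Set.Icc 0 A := ⟨le_rfl, hA⟩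
  have hz : (0 : ℝ) ^ p = 0 := Real.zero_rpow (by linarith)
  have mixed : ∀ x y : ℝ, |x| ≤ A → |y| ≤ A → y ≤ 0 → 0 ≤ x →
      |(|x| ^ (p - 1) * x) - |y| ^ (p - 1) * y| ≤ p * A ^ (p - 1) * |x - y| := by
    intro x y hx hy hy0 hx0
    rw [abs_of_nonneg hx0] at hx
    rw [abs_of_nonpos hy0] at hy
    rw [hpos x hx0, hneg y hy0, abs_of_nonneg (by linarith : 0 ≤ x - y)]
    have h1 := base 0 h0 x ⟨hx0, hx⟩
    have h2 := base 0 h0 (-y) ⟨by linarith, hy⟩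
    rw [hz, sub_zero, sub_zero, abs_of_nonneg hx0] at h1
    rw [hz, sub_zero, sub_zero, abs_of_nonneg (by linarith : 0 ≤ -y)] at h2
    rw [sub_neg_eq_add]
    refine (abs_add_le _ _).trans ?_
    linarith
  rcases le_total 0 x with hx0 | hx0 <;> rcases le_total 0 y with hy0 | hy0
  · rw [hpos x hx0, hpos y hy0]
    exact base y ⟨hy0, (le_abs_self y).trans hy⟩ x ⟨hx0, (le_abs_self x).trans hx⟩
  · exact mixed x y hx hy hy0 hx0
  · rw [abs_sub_comm, abs_sub_comm x y]
    exact mixed y x hy hx hx0 hy0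
  · rw [hneg x hx0, hneg y hy0]
    have := base (-x) ⟨by linarith, (neg_le_abs x).trans hx⟩ (-y)
      ⟨by linarith, (neg_le_abs y).trans hy⟩
    rwa [show -(-x) ^ p - -(-y) ^ p = (-y) ^ p - (-x) ^ p by ring,
      show x - y = -y - -x by ring]

/-- Second order Taylor bound for `|x|^{p+1} / (p+1)`. -/
theorem power_taylor_le {p a b : ℝ} (hp : 1 < p) :
    |a| ^ (p - 1) * a * (a - b) - 1 / (p + 1) * |a| ^ (p + 1) + 1 / (p + 1) * |b| ^ (p + 1) ≤
      p * ((|a| + |b|) ^ (p - 1) * (a - b) ^ 2) := by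
  have hp1 : p + 1 ≠ 0 := by linarith
  have hderiv : ∀ x : ℝ, HasDerivAt (fun x => 1 / (p + 1) * |x| ^ (p + 1))
      (|x| ^ (p - 1) * x) x := by
    intro x
    refine ((hasDerivAt_abs_rpow x (by linarith : 1 < p + 1)).const_mul
      (1 / (p + 1))).congr_deriv ?_
    rw [show p + 1 - 2 = p - 1 by ring]
    field_simp
  have hline : ∀ θ : ℝ, HasDerivAt (fun θ => 1 / (p + 1) * |b + θ * (a - b)| ^ (p + 1))
      (|b + θ * (a - b)| ^ (p - 1) * (b + θ * (a - b)) * (a - b)) θ := by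
    intro θ
    have h1 : HasDerivAt (fun θ : ℝ => b + θ * (a - b)) (1 * (a - b)) θ :=
      ((hasDerivAt_id θ).mul_const (a - b)).const_add b
    have h2 := (hderiv (b + θ * (a - b))).comp θ h1
    rw [one_mul] at h2
    exact h2
  obtain ⟨θ, hθ, hEq⟩ := exists_hasDerivAt_eq_slope
    (fun θ => 1 / (p + 1) * |b + θ * (a - b)| ^ (p + 1)) _ zero_lt_one
    (fun t _ => (hline t).continuousAt.continuousWithinAt) (fun t _ => hline t)
  set c := b + θ * (a - b) with hc
  have hcA : |c| ≤ |a| + |b| := by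
    rw [show c = θ * a + (1 - θ) * b by rw [hc]; ring]
    refine (abs_add_le _ _).trans ?_
    rw [abs_mul, abs_mul, abs_of_pos hθ.1, abs_of_nonneg (by linarith [hθ.2] : 0 ≤ 1 - θ)]
    have := hθ.1
    have := hθ.2
    nlinarith [abs_nonneg a, abs_nonneg b]
  have hlip := abs_rpow_mul_self_sub_le (A := |a| + |b|) hp
    (by linarith [abs_nonneg b] : |a| ≤ |a| + |b|) hcA
  have hac : |a - c| ≤ |a - b| := by
    rw [show a - c = (1 - θ) * (a - b) by rw [hc]; ring, abs_mul]
    refine mul_le_of_le_one_left (abs_nonneg _) ?_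
    rw [abs_le]
    constructor <;> linarith [hθ.1, hθ.2]
  simp only [one_mul, zero_mul, add_zero, sub_zero, div_one, add_sub_cancel] at hEq
  have hK : 0 ≤ p * (|a| + |b|) ^ (p - 1) := by positivity
  calc |a| ^ (p - 1) * a * (a - b) - 1 / (p + 1) * |a| ^ (p + 1) +
        1 / (p + 1) * |b| ^ (p + 1)
      = (|a| ^ (p - 1) * a - |c| ^ (p - 1) * c) * (a - b) := by rw [sub_mul, hEq]; ring
    _ ≤ |(|a| ^ (p - 1) * a - |c| ^ (p - 1) * c)| * |a - b| := by
        rw [← abs_mul]; exact le_abs_self _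
    _ ≤ (p * (|a| + |b|) ^ (p - 1) * |a - b|) * |a - b| := by
        gcongr
        exact hlip.trans (by gcongr)
    _ = p * ((|a| + |b|) ^ (p - 1) * (a - b) ^ 2) := by
        rw [← sq_abs (a - b)]; ring

/-- The first term covers A ≤ K, the second A > K. If q < m, a large K makes the coefficient of A^m
as small as desired; this is how subcriticality is exploited. -/
theorem rpow_le_add_rpow {A K q m : ℝ} (hA : 0 ≤ A) (hK : 0 < K) (hq : 0 ≤ q) (hqm : q ≤ m) :
    A ^ q ≤ K ^ q + K ^ (-(m - q)) * A ^ m := by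
  rcases le_or_gt A K with h | h
  · have := Real.rpow_le_rpow hA h hq
    have : 0 ≤ K ^ (-(m - q)) * A ^ m := by positivity
    linarith
  · have hA0 : 0 < A := hK.trans h
    have h1 : A ^ q = A ^ (-(m - q)) * A ^ m := by
      rw [← Real.rpow_add hA0]
      congr 1
      ring
    have h2 : A ^ (-(m - q)) ≤ K ^ (-(m - q)) :=
      Real.rpow_le_rpow_of_nonpos hK h.le (by linarith)
    have h3 : 0 ≤ K ^ q := by positivity
    have h4 : A ^ (-(m - q)) * A ^ m ≤ K ^ (-(m - q)) * A ^ m := by gcongr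
    linarith

end Pointwise

/-! ### The power nonlinearity and the energy step -/

section Nonlinear

variable {n : ℕ} {Ω : Set (E n)}

theorem sobolevExp_gt (hn : 3 ≤ n) : 2 < sobolevExp n := by
  have hn' : (3 : ℝ) ≤ n := by exact_mod_cast hn
  rw [sobolevExp, lt_div_iff₀ (by linarith)]
  linarith

theorem add_one_lt_sobolevExp (hn : 3 ≤ n) {p : ℝ} (hp : p < ((n : ℝ) + 2) / ((n : ℝ) - 2)) :
    p + 1 < sobolevExp n := by
  have hn' : (3 : ℝ) ≤ n := by exact_mod_cast hn
  rw [lt_div_iff₀ (by linarith)] at hp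
  rw [sobolevExp, lt_div_iff₀ (by linarith)]
  linarith

theorem memLp_fn_sobolev (hn : 3 ≤ n) (v : H01 Ω) :
    MemLp (fn v) (ENNReal.ofReal (sobolevExp n)) (volume.restrict Ω) := by
  obtain ⟨C, hC⟩ := exists_sobolev_const hn Ω
  exact ⟨Lp.aestronglyMeasurable _, (hC v).trans_lt
    (ENNReal.mul_lt_top ENNReal.coe_lt_top (Lp.memLp (grad v)).2)⟩

theorem isFiniteMeasure_restrict (hb : Bornology.IsBounded Ω) :
    IsFiniteMeasure (volume.restrict Ω) :=
  ⟨by simpa using hb.measure_lt_top⟩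

theorem integrable_abs_rpow_of_memLp (hb : Bornology.IsBounded Ω) {f : E n → ℝ}
    (hf : MemLp f (ENNReal.ofReal (sobolevExp n)) (volume.restrict Ω)) {r : ℝ} (hr : 0 < r)
    (hr' : r ≤ sobolevExp n) : Integrable (fun x => |f x| ^ r) (volume.restrict Ω) := by
  have := isFiniteMeasure_restrict hb
  have h := (hf.mono_exponent (ENNReal.ofReal_le_ofReal hr')).integrable_norm_rpow
    (by simpa using hr) (by simp)
  simpa [ENNReal.toReal_ofReal hr.le] using h

theorem integrable_abs_fn_rpow (hn : 3 ≤ n) (hb : Bornology.IsBounded Ω) (v : H01 Ω) {r : ℝ}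
    (hr : 0 < r) (hr' : r ≤ sobolevExp n) :
    Integrable (fun x => |fn v x| ^ r) (volume.restrict Ω) :=
  integrable_abs_rpow_of_memLp hb (memLp_fn_sobolev hn v) hr hr'

theorem integrable_power_mul (hn : 3 ≤ n) (hb : Bornology.IsBounded Ω) {p : ℝ} (hp₁ : 1 < p)
    (hp₂ : p + 1 ≤ sobolevExp n) (v w : H01 Ω) :
    Integrable (fun x => (|fn v x| ^ (p - 1) * fn v x) * fn w x) (volume.restrict Ω) := by
  refine ((integrable_abs_fn_rpow hn hb v (by linarith : 0 < p + 1) hp₂).add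
    (integrable_abs_fn_rpow hn hb w (by linarith : 0 < p + 1) hp₂)).mono' ?_ ?_
  · have h1 := (Lp.aestronglyMeasurable (fn v)).aemeasurable
    have h2 := (Lp.aestronglyMeasurable (fn w)).aemeasurable
    exact (((h1.abs.pow_const (p - 1)).mul h1).mul h2).aestronglyMeasurable
  · refine Eventually.of_forall fun x => ?_
    have key : ∀ a b : ℝ, 0 ≤ a → 0 ≤ b → a ^ (p - 1) * a * b ≤ a ^ (p + 1) + b ^ (p + 1) := by
      intro a b ha hb
      set m := max a b
      have hm : 0 ≤ m := ha.trans (le_max_left _ _)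
      have h1 : a ^ (p - 1) * a * b ≤ m ^ (p - 1) * m * m := by
        have := Real.rpow_le_rpow ha (le_max_left a b) (by linarith : 0 ≤ p - 1)
        gcongr
        · exact le_max_left _ _
        · exact le_max_right _ _
      have h2 : m ^ (p - 1) * m * m = m ^ (p + 1) := by
        rcases hm.eq_or_lt with h | h
        · rw [← h]
          simp [Real.zero_rpow (by linarith : p + 1 ≠ 0)]
        · rw [show p + 1 = p - 1 + 1 + 1 by ring, Real.rpow_add_one h.ne',
            Real.rpow_add_one h.ne']
      have h3 : m ^ (p + 1) ≤ a ^ (p + 1) + b ^ (p + 1) := by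
        have := Real.rpow_nonneg ha (p + 1)
        have := Real.rpow_nonneg hb (p + 1)
        rcases max_choice a b with h | h <;> simp only [m, h] <;> linarith
      linarith
    simp only [norm_mul, Real.norm_eq_abs, Pi.add_apply,
      abs_of_nonneg (Real.rpow_nonneg (abs_nonneg (fn v x)) (p - 1))]
    exact key _ _ (abs_nonneg _) (abs_nonneg _)

theorem integral_rpow_abs_eq (hn : 3 ≤ n) {f : E n → ℝ}
    (hf : MemLp f (ENNReal.ofReal (sobolevExp n)) (volume.restrict Ω)) :
    ∫ x in Ω, |f x| ^ sobolevExp n =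
      (eLpNorm f (ENNReal.ofReal (sobolevExp n)) (volume.restrict Ω)).toReal ^ sobolevExp n := by
  have hs : 0 < sobolevExp n := by linarith [sobolevExp_gt hn]
  have h0 : 0 ≤ ∫ x in Ω, |f x| ^ sobolevExp n := integral_nonneg fun x => by positivity
  rw [hf.eLpNorm_eq_integral_rpow_norm (by simpa using hs) (by simp), ENNReal.toReal_ofReal hs.le]
  simp only [Real.norm_eq_abs]
  rw [ENNReal.toReal_ofReal (by positivity), ← Real.rpow_mul h0, inv_mul_cancel₀ hs.ne',
    Real.rpow_one]

/-- Hölder with exponents n/2 and n/(n-2): both 4/(n-2) · n/2 and 2 · n/(n-2) equal 2*. -/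
theorem rpow_mul_sq_integrable_and_le (hn : 3 ≤ n) {f g : E n → ℝ} (hf0 : ∀ x, 0 ≤ f x)
    (hf : MemLp f (ENNReal.ofReal (sobolevExp n)) (volume.restrict Ω))
    (hg : MemLp g (ENNReal.ofReal (sobolevExp n)) (volume.restrict Ω)) :
    Integrable (fun x => f x ^ (4 / ((n : ℝ) - 2)) * g x ^ 2) (volume.restrict Ω) ∧
    ∫ x in Ω, f x ^ (4 / ((n : ℝ) - 2)) * g x ^ 2 ≤
      (eLpNorm f (ENNReal.ofReal (sobolevExp n)) (volume.restrict Ω)).toReal ^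
        (4 / ((n : ℝ) - 2)) *
      (eLpNorm g (ENNReal.ofReal (sobolevExp n)) (volume.restrict Ω)).toReal ^ 2 := by
  have hn' : (3 : ℝ) ≤ n := by exact_mod_cast hn
  have hn2 : (0 : ℝ) < n - 2 := by linarith
  have hs : 0 < sobolevExp n := by linarith [sobolevExp_gt hn]
  have hconj : ((n : ℝ) / 2).HolderConjugate (n / (n - 2)) := by
    rw [Real.holderConjugate_iff]
    refine ⟨by linarith, ?_⟩
    field_simp
    ring
  have e1 : ∀ x, (f x ^ (4 / ((n : ℝ) - 2))) ^ ((n : ℝ) / 2) = |f x| ^ sobolevExp n := by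
    intro x
    rw [← Real.rpow_mul (hf0 x), abs_of_nonneg (hf0 x)]
    congr 1
    rw [sobolevExp]
    field_simp
    ring
  have e2 : ∀ x, (g x ^ 2) ^ ((n : ℝ) / (n - 2)) = |g x| ^ sobolevExp n := by
    intro x
    rw [← sq_abs, ← Real.rpow_natCast, ← Real.rpow_mul (abs_nonneg _)]
    congr 1
    rw [sobolevExp]
    push_cast
    field_simp
  have hsf : Integrable (fun x => |f x| ^ sobolevExp n) (volume.restrict Ω) := by
    simpa [ENNReal.toReal_ofReal hs.le] using
      hf.integrable_norm_rpow (by simpa using hs) (by simp)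
  have hsg : Integrable (fun x => |g x| ^ sobolevExp n) (volume.restrict Ω) := by
    simpa [ENNReal.toReal_ofReal hs.le] using
      hg.integrable_norm_rpow (by simpa using hs) (by simp)
  have m1 : MemLp (fun x => f x ^ (4 / ((n : ℝ) - 2))) (ENNReal.ofReal (n / 2))
      (volume.restrict Ω) := by
    rw [← integrable_norm_rpow_iff (hf.1.aemeasurable.pow_const _).aestronglyMeasurable
      (by simpa using hconj.pos) (by simp), ENNReal.toReal_ofReal hconj.nonneg]
    refine hsf.congr (Eventually.of_forall fun x => ?_)
    simp only
    rw [← e1, Real.norm_of_nonneg (Real.rpow_nonneg (hf0 x) _)]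
  have m2 : MemLp (fun x => g x ^ 2) (ENNReal.ofReal (n / (n - 2))) (volume.restrict Ω) := by
    rw [← integrable_norm_rpow_iff (hg.1.aemeasurable.pow_const 2).aestronglyMeasurable
      (by simpa using hconj.symm.pos) (by simp), ENNReal.toReal_ofReal hconj.symm.nonneg]
    refine hsg.congr (Eventually.of_forall fun x => ?_)
    simp only
    rw [← e2, Real.norm_of_nonneg (sq_nonneg _)]
  have h1 := integral_mul_le_Lp_mul_Lq_of_nonneg hconj
    (Eventually.of_forall fun x => Real.rpow_nonneg (hf0 x) _)
    (Eventually.of_forall fun x => sq_nonneg (g x)) m1 m2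
  refine ⟨?_, h1.trans_eq ?_⟩
  · have : ENNReal.HolderConjugate (ENNReal.ofReal ((n : ℝ) / 2)) (ENNReal.ofReal (n / (n - 2))) :=
      hconj.ennrealOfReal
    exact m1.integrable_mul m2
  · simp only [e1, e2]
    rw [integral_rpow_abs_eq hn hf, integral_rpow_abs_eq hn hg,
      ← Real.rpow_mul ENNReal.toReal_nonneg, ← Real.rpow_mul ENNReal.toReal_nonneg,
      ← Real.rpow_natCast]
    congr 2
    · rw [sobolevExp]
      field_simp
      ring
    · rw [sobolevExp]
      push_cast
      field_simp

/-- The pointwise Taylor bound has weight (|a|+|b|)^{p-1}, which is split at the threshold K into a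
constant, paired with the L² norm of d, and the higher power m, paired with the Sobolev norm. -/
theorem integral_power_taylor_le {α : Type*} {_ : MeasurableSpace α} {μ : Measure α}
    {a b d : α → ℝ} {p m K : ℝ} (hp : 1 < p) (hpm : p - 1 ≤ m) (hK : 0 < K)
    (i2 : Integrable (fun x => d x ^ 2) μ)
    (i3 : Integrable (fun x => (|a x| ^ (p - 1) * a x) * d x) μ)
    (i4 : Integrable (fun x => |a x| ^ (p + 1)) μ) (i5 : Integrable (fun x => |b x| ^ (p + 1)) μ)
    (iA : Integrable (fun x => (|a x| + |b x|) ^ m * d x ^ 2) μ)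
    (hd : ∀ᵐ x ∂μ, d x = a x - b x) :
    (∫ x, (|a x| ^ (p - 1) * a x) * d x ∂μ) - 1 / (p + 1) * (∫ x, |a x| ^ (p + 1) ∂μ) +
        1 / (p + 1) * ∫ x, |b x| ^ (p + 1) ∂μ ≤
      p * (K ^ (p - 1) * (∫ x, d x ^ 2 ∂μ) + K ^ (-(m - (p - 1))) *
        ∫ x, (|a x| + |b x|) ^ m * d x ^ 2 ∂μ) := by
  have j4 := i4.const_mul (1 / (p + 1))
  have j5 := i5.const_mul (1 / (p + 1))
  have j34 : Integrable (fun x => (|a x| ^ (p - 1) * a x) * d x -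
    1 / (p + 1) * |a x| ^ (p + 1)) μ := i3.sub j4
  have j2 := i2.const_mul (K ^ (p - 1))
  have jA := iA.const_mul (K ^ (-(m - (p - 1))))
  rw [← integral_const_mul, ← integral_const_mul, ← integral_const_mul, ← integral_const_mul,
    ← integral_sub i3 j4, ← integral_add j34 j5, ← integral_add j2 jA, ← integral_const_mul]
  refine integral_mono_ae (j34.add j5) ((j2.add jA).const_mul _) ?_
  filter_upwards [hd] with x hx
  simp only [hx]
  refine (power_taylor_le hp).trans ?_
  have h1 := rpow_le_add_rpow (A := |a x| + |b x|) (by positivity) hK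
    (by linarith : 0 ≤ p - 1) hpm
  have h2 := mul_le_mul_of_nonneg_right h1 (sq_nonneg (a x - b x))
  refine mul_le_mul_of_nonneg_left (h2.trans_eq ?_) (by linarith)
  ring

theorem exists_sobolev_toReal_le (hn : 3 ≤ n) (Ω : Set (E n)) : ∃ S : ℝ, 0 ≤ S ∧ ∀ v : H01 Ω,
    (eLpNorm (fn v) (ENNReal.ofReal (sobolevExp n)) (volume.restrict Ω)).toReal ≤
      S * ‖grad v‖ := by
  obtain ⟨S, hS⟩ := exists_sobolev_const hn Ω
  refine ⟨S, S.2, fun v => ?_⟩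
  rw [Lp.norm_def, ← ENNReal.coe_toReal S, ← ENNReal.toReal_mul]
  exact ENNReal.toReal_mono
    (ENNReal.mul_lt_top ENNReal.coe_lt_top (Lp.memLp (grad v)).2).ne (hS v)

theorem integrable_and_integral_rpow_mul_sq_le (hn : 3 ≤ n) {S M : ℝ} (hS0 : 0 ≤ S) (hM : 0 ≤ M)
    (hS : ∀ v : H01 Ω,
      (eLpNorm (fn v) (ENNReal.ofReal (sobolevExp n)) (volume.restrict Ω)).toReal ≤ S * ‖grad v‖)
    {v w : H01 Ω} (hv : ‖v‖ ≤ M) (hw : ‖w‖ ≤ M) (z : H01 Ω) :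
    Integrable (fun x => (|fn v x| + |fn w x|) ^ (4 / ((n : ℝ) - 2)) * fn z x ^ 2)
      (volume.restrict Ω) ∧
    ∫ x in Ω, (|fn v x| + |fn w x|) ^ (4 / ((n : ℝ) - 2)) * fn z x ^ 2 ≤
      (2 * S * M) ^ (4 / ((n : ℝ) - 2)) * S ^ 2 * ‖grad z‖ ^ 2 := by
  have hn' : (3 : ℝ) ≤ n := by exact_mod_cast hn
  have hm0 : (0 : ℝ) ≤ 4 / ((n : ℝ) - 2) := div_nonneg (by norm_num) (by linarith)
  have mv := memLp_fn_sobolev hn v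
  have mw := memLp_fn_sobolev hn w
  have hq1 : 1 ≤ ENNReal.ofReal (sobolevExp n) := by
    rw [ENNReal.one_le_ofReal]
    linarith [sobolevExp_gt hn]
  have mA : MemLp (fun x => |fn v x| + |fn w x|) (ENNReal.ofReal (sobolevExp n))
    (volume.restrict Ω) := mv.norm.add mw.norm
  have hAb : (eLpNorm (fun x => |fn v x| + |fn w x|) (ENNReal.ofReal (sobolevExp n))
      (volume.restrict Ω)).toReal ≤ 2 * S * M := by
    have h1 := eLpNorm_add_le mv.norm.1 mw.norm.1 hq1
    rw [eLpNorm_norm, eLpNorm_norm] at h1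
    have h2 := ENNReal.toReal_mono (ENNReal.add_lt_top.2 ⟨mv.2, mw.2⟩).ne h1
    rw [ENNReal.toReal_add mv.2.ne mw.2.ne] at h2
    have h3 := (hS v).trans (mul_le_mul_of_nonneg_left ((norm_grad_le v).trans hv) hS0)
    have h4 := (hS w).trans (mul_le_mul_of_nonneg_left ((norm_grad_le w).trans hw) hS0)
    refine le_trans h2 ?_
    linarith
  obtain ⟨iA, hA⟩ := rpow_mul_sq_integrable_and_le hn (f := fun x => |fn v x| + |fn w x|)
    (fun x => by positivity) mA (memLp_fn_sobolev hn z)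
  refine ⟨iA, hA.trans ?_⟩
  rw [mul_assoc, ← mul_pow]
  have h0 : 0 ≤ 2 * S * M := by positivity
  exact mul_le_mul (Real.rpow_le_rpow ENNReal.toReal_nonneg hAb hm0)
    (pow_le_pow_left₀ ENNReal.toReal_nonneg (hS z) 2) (by positivity) (Real.rpow_nonneg h0 _)

theorem integral_fn_sq_le (hn : 3 ≤ n) {D : L2 Ω →L[ℝ] L2 Ω}
    (hD : ∀ f, D f =ᵐ[volume.restrict Ω] fun x => ‖x‖ * f x) (v : H01 Ω) :
    ∫ x in Ω, fn v x ^ 2 ≤ ‖D‖ ^ 2 * ‖weighted hn v‖ ^ 2 := by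
  have h1 := integral_norm_sq_eq (fn v)
  simp only [Real.norm_eq_abs, sq_abs] at h1
  rw [h1, ← normMul_weighted hn hD, ← mul_pow]
  exact pow_le_pow_left₀ (norm_nonneg _) (D.le_opNorm _) 2

theorem exists_pos_mul_rpow_neg_le (B : ℝ) {r : ℝ} (hr : 0 < r) :
    ∃ K : ℝ, 0 < K ∧ B * K ^ (-r) ≤ 1 / 2 := by
  have h1 : Tendsto (fun K : ℝ => B * K ^ (-r)) atTop (𝓝 (B * 0)) :=
    (tendsto_rpow_neg_atTop hr).const_mul _
  rw [mul_zero] at h1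
  obtain ⟨K, h2, h3⟩ := ((h1.eventually_le_const (by norm_num : (0 : ℝ) < 1 / 2)).and
    (eventually_gt_atTop 0)).exists
  exact ⟨K, h3, h2⟩

/-- Here m = 4/(n-2), the exponent at which Hölder and Sobolev close up; p - 1 < m is exactly
subcriticality. -/
theorem exists_weight_bound (hn : 3 ≤ n) {p : ℝ} (hp : p < ((n : ℝ) + 2) / ((n : ℝ) - 2))
    {M : ℝ} (hM : 0 ≤ M) : ∃ m A : ℝ, p - 1 < m ∧ 0 ≤ A ∧
      ∀ v w : H01 Ω, ‖v‖ ≤ M → ‖w‖ ≤ M →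
        Integrable (fun x => (|fn v x| + |fn w x|) ^ m * fn (v - w) x ^ 2) (volume.restrict Ω) ∧
        ∫ x in Ω, (|fn v x| + |fn w x|) ^ m * fn (v - w) x ^ 2 ≤
          A * ‖grad (v - w)‖ ^ 2 := by
  have hn' : (3 : ℝ) ≤ n := by exact_mod_cast hn
  have hn2 : (0 : ℝ) < n - 2 := by linarith
  obtain ⟨S, hS0, hS⟩ := exists_sobolev_toReal_le hn Ω
  refine ⟨4 / ((n : ℝ) - 2), (2 * S * M) ^ (4 / ((n : ℝ) - 2)) * S ^ 2, ?_, ?_,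
    fun v w hv hw => integrable_and_integral_rpow_mul_sq_le hn hS0 hM hS hv hw (v - w)⟩
  · rw [lt_div_iff₀ hn2] at hp ⊢
    linarith
  · have : 0 ≤ 2 * S * M := by positivity
    positivity

theorem mul_le_of_absorption {κ κ₀ p K₁ K₂ X Y Z A g d e : ℝ} (hκ : κ ∈ Set.Icc 0 κ₀)
    (hp : 0 ≤ p) (hK₁ : 0 ≤ K₁) (hK₂ : 0 ≤ K₂) (hX0 : 0 ≤ X) (hY0 : 0 ≤ Y) (hg : 0 ≤ g)
    (hZ : Z ≤ p * (K₁ * X + K₂ * Y)) (hX : X ≤ d * e) (hY : Y ≤ A * g)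
    (hA : κ₀ * p * A * K₂ ≤ 1 / 2) : κ * Z ≤ 1 / 2 * g + κ₀ * p * K₁ * d * e := by
  have h0 : 0 ≤ κ₀ := hκ.1.trans hκ.2
  have h1 := mul_le_mul_of_nonneg_left hZ hκ.1
  have h2 : κ * (p * (K₁ * X + K₂ * Y)) ≤ κ₀ * (p * (K₁ * X + K₂ * Y)) :=
    mul_le_mul_of_nonneg_right hκ.2 (by positivity)
  have h3 : κ₀ * (p * (K₁ * X + K₂ * Y)) ≤ κ₀ * (p * (K₁ * (d * e) + K₂ * (A * g))) := by
    gcongr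
  have h4 := mul_le_mul_of_nonneg_right hA hg
  linarith

set_option maxHeartbeats 1000000 in
/-- The Taylor remainder of the superlinear subcritical term is absorbed by the gradient. -/
theorem exists_taylor_remainder_bound (hn : 3 ≤ n) (hb : Bornology.IsBounded Ω)
    (hm : MeasurableSet Ω) {p : ℝ} (hp₁ : 1 < p) (hp₂ : p < ((n : ℝ) + 2) / ((n : ℝ) - 2))
    {κ₀ M : ℝ} (hM : 0 ≤ M) :
    ∃ C : ℝ, ∀ κ ∈ Set.Icc 0 κ₀, ∀ v w : H01 Ω, ‖v‖ ≤ M → ‖w‖ ≤ M →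
      κ * ((∫ x in Ω, (|fn v x| ^ (p - 1) * fn v x) * fn (v - w) x) -
        1 / (p + 1) * (∫ x in Ω, |fn v x| ^ (p + 1)) +
        1 / (p + 1) * ∫ x in Ω, |fn w x| ^ (p + 1)) ≤
      1 / 2 * ‖grad (v - w)‖ ^ 2 + C * ‖weighted hn (v - w)‖ ^ 2 := by
  have hps := (add_one_lt_sobolevExp hn hp₂).le
  obtain ⟨D, hD, -⟩ := exists_normMul hn hb hm
  have hL2 := integral_fn_sq_le hn hD
  obtain ⟨m, A, hpm, hSM, hAll⟩ := exists_weight_bound (Ω := Ω) hn hp₂ hM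
  have hp0 : 0 < p := one_pos.trans hp₁
  have hp1 : 0 < p + 1 := add_pos hp0 one_pos
  -- K is so large that the critical part costs at most ½‖∇(v - w)‖², the surplus available in the
  -- energy step. The remaining L² part is controlled by the weighted norm because |x| is bounded on
  -- Ω.
  obtain ⟨K, hK0, hK⟩ := exists_pos_mul_rpow_neg_le (κ₀ * p * A) (sub_pos.2 hpm)
  refine ⟨κ₀ * p * K ^ (p - 1) * ‖D‖ ^ 2, fun κ hκ v w hv hw => ?_⟩
  have iA := (hAll v w hv hw).1
  have hA := (hAll v w hv hw).2
  have i2 : Integrable (fun x => fn (v - w) x ^ 2) (volume.restrict Ω) := by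
    simpa using (Lp.memLp (fn (v - w))).integrable_norm_pow (by norm_num)
  have hmain := integral_power_taylor_le hp₁ hpm.le hK0 i2
    (integrable_power_mul hn hb hp₁ hps v (v - w))
    (integrable_abs_fn_rpow hn hb v hp1 hps)
    (integrable_abs_fn_rpow hn hb w hp1 hps) iA
    (by rw [fn_sub]; exact Lp.coeFn_sub _ _)
  have hKp : 0 < K ^ (p - 1) := Real.rpow_pos_of_pos hK0 _
  have hKm : 0 < K ^ (-(m - (p - 1))) := Real.rpow_pos_of_pos hK0 _
  have hX := hL2 (v - w)
  have hX0 : 0 ≤ ∫ x in Ω, fn (v - w) x ^ 2 := integral_nonneg fun x => by positivity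
  have hY0 : 0 ≤ ∫ x in Ω, (|fn v x| + |fn w x|) ^ m * fn (v - w) x ^ 2 :=
    integral_nonneg fun x => by positivity
  exact mul_le_of_absorption hκ hp0.le hKp.le hKm.le hX0 hY0 (sq_nonneg _) hmain hX hA hK

/-- One implicit time step decreases the energy, up to a quadratic error in the step. -/
theorem exists_energy_step_bound (hn : 3 ≤ n) (hb : Bornology.IsBounded Ω)
    (hm : MeasurableSet Ω) {p : ℝ} (hp₁ : 1 < p) (hp₂ : p < ((n : ℝ) + 2) / ((n : ℝ) - 2))
    (k : ℝ → ℝ) {κ₀ M : ℝ} (hM : 0 ≤ M) :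
    ∃ C : ℝ, ∀ s t : ℝ, ∀ v w : H01 Ω, ∀ W : L2 Ω, 0 ≤ k s → k s ≤ k t → k t ≤ κ₀ →
      ‖v‖ ≤ M → ‖w‖ ≤ M →
      (∀ z : H01 Ω, inner ℝ W (weighted hn z) + inner ℝ (grad v) (grad z) =
        k t * ∫ x in Ω, (|fn v x| ^ (p - 1) * fn v x) * fn z x) →
      energy p k v t - energy p k w s ≤
        -inner ℝ (weighted hn v - weighted hn w) W +
          C * ‖weighted hn v - weighted hn w‖ ^ 2 := by
  obtain ⟨C, hC⟩ := exists_taylor_remainder_bound hn hb hm hp₁ hp₂ (κ₀ := κ₀) hM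
  refine ⟨C, fun s t v w W hs hst ht hv hw hweak => ?_⟩
  have h1 := hC (k t) ⟨hs.trans hst, ht⟩ v w hv hw
  have h2 := hweak (v - w)
  rw [weighted_sub, grad_sub] at h1 h2
  -- The last term is the surplus that pays for the Taylor remainder.
  have h3 : inner ℝ (grad v) (grad v - grad w) =
      1 / 2 * ‖grad v‖ ^ 2 - 1 / 2 * ‖grad w‖ ^ 2 + 1 / 2 * ‖grad v - grad w‖ ^ 2 := by
    rw [norm_sub_sq_real, inner_sub_right, real_inner_self_eq_norm_sq]
    ring
  have h4 : 0 ≤ ∫ x in Ω, |fn w x| ^ (p + 1) := integral_nonneg fun x => by positivity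
  -- Monotonicity of k enters here: replacing k(s) by k(t) only increases the energy difference to
  -- be bounded.
  have h5 : k s / (p + 1) * (∫ x in Ω, |fn w x| ^ (p + 1)) ≤
      k t / (p + 1) * ∫ x in Ω, |fn w x| ^ (p + 1) := by
    gcongr
  have h6 : ∀ y : ℝ, k t / (p + 1) * y = k t * (1 / (p + 1) * y) := fun y => by ring
  rw [energy, energy, integral_norm_sq_eq, integral_norm_sq_eq]
  rw [h6] at h5 ⊢
  rw [real_inner_comm W]
  rw [h3] at h2
  linarith

end Nonlinear

/-! ### Weak solutions: Hilbert space form, energy inequality, lifespan -/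

section WeakSolution

variable {n : ℕ} {Ω : Set (E n)}

theorem AssumptionA.monotoneOn {k : ℝ → ℝ} (hk : AssumptionA k) : MonotoneOn k (Set.Ici 0) := by
  refine monotoneOn_of_deriv_nonneg (convex_Ici 0) hk.contDiffOn.continuousOn
    ((hk.contDiffOn.differentiableOn (by simp)).mono interior_subset) fun x hx => ?_
  rw [interior_Ici] at hx
  rw [← derivWithin_of_mem_nhds (Ici_mem_nhds hx)]
  exact hk.deriv_nonneg x (Set.mem_Ioi.1 hx).le

theorem continuous_grad : Continuous (grad : H01 Ω → L2Vec Ω) :=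
  (WithLp.sndL 2 ℝ (L2 Ω) (L2Vec Ω)).continuous.comp continuous_subtype_val

theorem lintegral_div_norm_eq_enorm_sq (hn : 3 ≤ n) {D : L2 Ω →L[ℝ] L2 Ω}
    (hD : ∀ f, D f =ᵐ[volume.restrict Ω] fun x => ‖x‖ * f x) (g : L2 Ω) :
    ∫⁻ x in Ω, (‖D g x‖ₑ / ‖x‖ₑ) ^ 2 = ‖g‖ₑ ^ 2 := by
  rw [Lp.enorm_def, eLpNorm_eq_lintegral_rpow_enorm_toReal (by norm_num) (by norm_num)]
  simp only [ENNReal.toReal_ofNat, ENNReal.rpow_two]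
  rw [← ENNReal.rpow_natCast, ← ENNReal.rpow_mul]
  norm_num
  refine lintegral_congr_ae ?_
  filter_upwards [hD g, ae_ne_zero hn] with x hx h0
  have h1 : ‖x‖ₑ ≠ 0 := by simpa using h0
  rw [hx, enorm_mul, enorm_norm, mul_comm, ENNReal.mul_div_cancel_right h1 (by simp)]

theorem mem_range_of_lintegral_div_norm_lt_top (hn : 3 ≤ n) {D : L2 Ω →L[ℝ] L2 Ω}
    (hD : ∀ f, D f =ᵐ[volume.restrict Ω] fun x => ‖x‖ * f x) {f : L2 Ω}
    (hf : ∫⁻ x in Ω, (‖f x‖ₑ / ‖x‖ₑ) ^ 2 < ⊤) : f ∈ Set.range D := by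
  have hm : MemLp (fun x => ‖x‖⁻¹ * f x) 2 (volume.restrict Ω) := by
    refine ⟨measurable_norm.inv.aestronglyMeasurable.mul (Lp.aestronglyMeasurable _), ?_⟩
    rw [eLpNorm_lt_top_iff_lintegral_rpow_enorm_lt_top (by norm_num) (by norm_num)]
    simp only [ENNReal.toReal_ofNat, ENNReal.rpow_two]
    refine lt_of_eq_of_lt (lintegral_congr_ae ?_) hf
    filter_upwards [ae_ne_zero hn] with x h0
    rw [enorm_mul, enorm_inv (norm_ne_zero_iff.2 h0), enorm_norm, mul_comm,
      ENNReal.div_eq_inv_mul, mul_comm]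
  refine ⟨hm.toLp _, Lp.ext ?_⟩
  filter_upwards [hD (hm.toLp _), hm.coeFn_toLp, ae_ne_zero hn] with x h1 h2 h3
  rw [h1, h2, mul_inv_cancel_left₀ (norm_ne_zero_iff.2 h3)]

/-- The time derivative of a weak solution, divided by `|x|`, is a square integrable function of
time with values in `L²(Ω)`. -/
theorem exists_weighted_derivative (hn : 3 ≤ n) {D : L2 Ω →L[ℝ] L2 Ω}
    (hD : ∀ f, D f =ᵐ[volume.restrict Ω] fun x => ‖x‖ * f x) (hinj : Function.Injective D)
    {T : ℝ} {w : ℝ → L2 Ω} (hw : AEStronglyMeasurable w (volume.restrict (Set.Ioo 0 T)))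
    (hfin : (∫⁻ t in Set.Ioo 0 T, ∫⁻ x in Ω, (‖w t x‖ₑ / ‖x‖ₑ) ^ 2) < ⊤) :
    ∃ W : ℝ → L2 Ω, MemLp W 2 volume ∧ (∀ t ≤ 0, W t = 0) ∧
      ∀ᵐ t ∂(volume.restrict (Set.Ioo 0 T)), D (W t) = w t := by
  classical
  have : Fact ((2 : ENNReal) ≠ ⊤) := ⟨by norm_num⟩
  let : MeasurableSpace ↥(L2 Ω) := borel _
  have : BorelSpace ↥(L2 Ω) := ⟨rfl⟩
  -- By the Lusin–Souslin theorem an injective continuous map between Polish spaces is a Borel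
  -- embedding, so division by |x|, extended by 0 off the range of D, is a Borel map on L²(Ω).
  have hemb : MeasurableEmbedding D := D.continuous.measurableEmbedding hinj
  set Φ : L2 Ω → ENNReal := fun f => ∫⁻ x in Ω, (‖f x‖ₑ / ‖x‖ₑ) ^ 2 with hΦ
  -- Off the range of D the weighted integral is infinite, so the default value ⊤ is the true one;
  -- this form shows that Φ is Borel.
  have hΦe : Φ = Function.extend D (fun g => ‖g‖ₑ ^ 2) fun _ => ⊤ := by
    funext f
    by_cases hf : ∃ g, D g = f
    · obtain ⟨g, rfl⟩ := hf
      rw [hinj.extend_apply]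
      exact lintegral_div_norm_eq_enorm_sq hn hD g
    · rw [Function.extend_apply' _ _ _ hf]
      by_contra hcon
      exact hf (mem_range_of_lintegral_div_norm_lt_top hn hD (lt_top_iff_ne_top.2 hcon))
  have hΦm : Measurable Φ := by
    rw [hΦe]
    exact hemb.measurable_extend (by fun_prop) measurable_const
  set R : L2 Ω → L2 Ω := Function.extend D id fun _ => 0 with hR
  have hRm : Measurable R := hemb.measurable_extend measurable_id measurable_const
  have hfin' : ∀ᵐ t ∂(volume.restrict (Set.Ioo 0 T)), Φ (w t) < ⊤ :=
    ae_lt_top' (hΦm.comp_aemeasurable hw.aemeasurable) hfin.ne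
  have hDR : ∀ᵐ t ∂(volume.restrict (Set.Ioo 0 T)), D (R (w t)) = w t := by
    filter_upwards [hfin'] with t ht
    obtain ⟨g, hg⟩ := mem_range_of_lintegral_div_norm_lt_top hn hD ht
    rw [← hg, hR, hinj.extend_apply, id]
  -- Extending by zero makes W globally square integrable and its primitive constant for t ≤ 0, as
  -- backward differences require.
  refine ⟨(Set.Ioo 0 T).indicator fun t => R (w t), ?_, fun t ht => ?_, ?_⟩
  · rw [memLp_indicator_iff_restrict measurableSet_Ioo]
    refine ⟨(hRm.comp_aemeasurable hw.aemeasurable).aestronglyMeasurable, ?_⟩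
    rw [eLpNorm_lt_top_iff_lintegral_rpow_enorm_lt_top (by norm_num) (by norm_num)]
    simp only [ENNReal.toReal_ofNat, ENNReal.rpow_two]
    refine lt_of_eq_of_lt (lintegral_congr_ae ?_) hfin
    filter_upwards [hDR] with t ht
    rw [← lintegral_div_norm_eq_enorm_sq hn hD, ht]
  · exact Set.indicator_of_notMem (fun h => absurd h.1 (not_lt.2 ht)) _
  · filter_upwards [hDR, ae_restrict_mem measurableSet_Ioo] with t ht hmem
    rw [Set.indicator_of_mem hmem, ht]

theorem integral_mul_div_norm_sq_eq_inner (hn : 3 ≤ n) {D : L2 Ω →L[ℝ] L2 Ω}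
    (hD : ∀ f, D f =ᵐ[volume.restrict Ω] fun x => ‖x‖ * f x) (W : L2 Ω) (v : H01 Ω) :
    ∫ x in Ω, D W x * fn v x / ‖x‖ ^ 2 = inner ℝ W (weighted hn v) := by
  rw [L2.inner_def]
  refine integral_congr_ae ?_
  filter_upwards [hD W, coeFn_weighted hn v, ae_ne_zero hn] with x h1 h2 h3
  have h4 := norm_ne_zero_iff.2 h3
  rw [h1, h2]
  simp only [RCLike.inner_apply, conj_trivial]
  field_simp

/-- The data of a weak solution after division by `|x|`: `U = u / |x|` is the primitive of a
square integrable `W`, and the weak equation holds with `W = u_t / |x|`. -/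
theorem IsWeakSolution.exists_hilbert_form (hn : 3 ≤ n) (hb : Bornology.IsBounded Ω)
    (hm : MeasurableSet Ω) {p : ℝ} {k : ℝ → ℝ} {u₀ : H01 Ω} {u : ℝ → H01 Ω} {T : ℝ}
    (hu : IsWeakSolution p k u₀ u T) :
    ∃ W : ℝ → L2 Ω, MemLp W 2 volume ∧
      (∀ t ≤ 0, primitive (weighted hn u₀) W t = weighted hn u₀) ∧
      (∀ t ∈ Set.Ico 0 T, primitive (weighted hn u₀) W t = weighted hn (u t)) ∧
      ∀ᵐ t ∂(volume.restrict (Set.Ioo 0 T)), ∀ v : H01 Ω,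
        inner ℝ (W t) (weighted hn v) + inner ℝ (grad (u t)) (grad v) =
          k t * ∫ x in Ω, (|fn (u t) x| ^ (p - 1) * fn (u t) x) * fn v x := by
  obtain ⟨w, hw, hfin, hint, hweak⟩ := hu.weak
  obtain ⟨D, hD, hinj⟩ := exists_normMul hn hb hm
  obtain ⟨W, hW, hW0, hDW⟩ := exists_weighted_derivative hn hD hinj hw hfin
  refine ⟨W, hW, fun t ht => ?_, fun t ht => hinj ?_, ?_⟩
  · have h0 : ∫ s in (0 : ℝ)..t, W s = 0 := by
      rw [intervalIntegral.integral_congr (g := fun _ => 0)]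
      · simp
      · intro s hs
        rw [Set.uIcc_of_ge ht] at hs
        exact hW0 s hs.2
    rw [primitive, h0, add_zero]
  -- The identity is checked after applying the injective operator D, which commutes with the time
  -- integral and turns u/|x| back into u.
  · rw [normMul_weighted hn hD, hint t ht, primitive, map_add, normMul_weighted hn hD,
      ← ContinuousLinearMap.intervalIntegral_comp_comm D (intervalIntegrable_of_memLp_two hW 0 t)]
    congr 1
    refine intervalIntegral.integral_congr_ae ?_
    rw [ae_restrict_iff' measurableSet_Ioo] at hDW
    filter_upwards [hDW] with s hs hst
    rw [Set.uIoc_of_le ht.1] at hst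
    exact hs ⟨hst.1, hst.2.trans_lt ht.2⟩
  · filter_upwards [hweak, hDW] with t h1 h2 v
    rw [← h1 v, ← h2, integral_mul_div_norm_sq_eq_inner hn hD, L2.inner_def (grad (u t))]

theorem integral_power_mul_self (p : ℝ) (hp : 1 < p) (v : H01 Ω) :
    ∫ x in Ω, (|fn v x| ^ (p - 1) * fn v x) * fn v x = ∫ x in Ω, |fn v x| ^ (p + 1) := by
  refine integral_congr_ae (Eventually.of_forall fun x => ?_)
  simp only
  rw [mul_assoc, ← sq, ← sq_abs]
  rcases (abs_nonneg (fn v x)).eq_or_lt with h | h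
  · rw [← h]
    simp [Real.zero_rpow (by linarith : p + 1 ≠ 0)]
  · rw [show p + 1 = p - 1 + (2 : ℕ) by push_cast; ring, Real.rpow_add_natCast h.ne']

theorem ae_norm_le_of_memLp_top {u : ℝ → H01 Ω} {T : ℝ}
    (hu : MemLp u ⊤ (volume.restrict (Set.Ioo 0 T))) (u₀ : H01 Ω) :
    ∃ M : ℝ, 0 ≤ M ∧ ‖u₀‖ ≤ M ∧ ∀ᵐ t ∂(volume.restrict (Set.Ioo 0 T)), ‖u t‖ ≤ M := by
  set B := (eLpNorm u ⊤ (volume.restrict (Set.Ioo 0 T))).toReal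
  refine ⟨max B ‖u₀‖, (norm_nonneg _).trans (le_max_right _ _), le_max_right _ _, ?_⟩
  filter_upwards [enorm_ae_le_eLpNormEssSup u (volume.restrict (Set.Ioo 0 T))] with t ht
  refine le_trans ?_ (le_max_left _ _)
  rw [← eLpNorm_exponent_top] at ht
  rw [← toReal_enorm]
  exact ENNReal.toReal_mono hu.2.ne ht

/-- The energy identity obtained by testing the equation with the solution. -/
theorem inner_eq_of_weak (hn : 3 ≤ n) {p : ℝ} (hp : 1 < p) {k : ℝ → ℝ} {t : ℝ} {v : H01 Ω}
    {W : L2 Ω} (h : inner ℝ W (weighted hn v) + inner ℝ (grad v) (grad v) =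
      k t * ∫ x in Ω, (|fn v x| ^ (p - 1) * fn v x) * fn v x) :
    inner ℝ W (weighted hn v) = (p - 1) / 2 * ‖grad v‖ ^ 2 - (p + 1) * energy p k v t := by
  have hp1 : p + 1 ≠ 0 := by linarith
  rw [integral_power_mul_self p hp, real_inner_self_eq_norm_sq] at h
  rw [energy, integral_norm_sq_eq]
  field_simp
  linarith

/-- The equation tested with u expresses the energy through ‖∇u‖² and ⟨U, W⟩, so the L^{p+1} term
needs no separate argument for measurability in time. -/
theorem integrableOn_energy (hn : 3 ≤ n) {p : ℝ} (hp : 1 < p) {k : ℝ → ℝ} {u₀ : H01 Ω}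
    {u : ℝ → H01 Ω} {T M : ℝ} (hT : 0 ≤ T)
    (hu : AEStronglyMeasurable u (volume.restrict (Set.Ioo 0 T)))
    (hM : ∀ᵐ t ∂(volume.restrict (Set.Ioo 0 T)), ‖u t‖ ≤ M) {W : ℝ → L2 Ω}
    (hW : MemLp W 2 volume)
    (hpos : ∀ t ∈ Set.Ico 0 T, primitive (weighted hn u₀) W t = weighted hn (u t))
    (hweak : ∀ᵐ t ∂(volume.restrict (Set.Ioo 0 T)),
        inner ℝ (W t) (weighted hn (u t)) = (p - 1) / 2 * ‖grad (u t)‖ ^ 2 -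
          (p + 1) * energy p k (u t) t) :
    IntegrableOn (fun t => energy p k (u t) t) (Set.Ioo 0 T) := by
  have hp1 : p + 1 ≠ 0 := by linarith
  have i1 : IntegrableOn (fun t => ‖grad (u t)‖ ^ 2) (Set.Ioo 0 T) := by
    refine Integrable.of_bound
      ((continuous_grad.comp_aestronglyMeasurable hu).norm.pow 2) (M ^ 2) ?_
    filter_upwards [hM] with t ht
    rw [Real.norm_of_nonneg (by positivity)]
    exact pow_le_pow_left₀ (norm_nonneg _) ((norm_grad_le _).trans ht) 2
  have i2 : IntegrableOn (fun t => inner ℝ (primitive (weighted hn u₀) W t) (W t))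
      (Set.Ioo 0 T) :=
    (intervalIntegrable_iff_integrableOn_Ioo_of_le hT).1
      (intervalIntegrable_inner_primitive hW (weighted hn u₀) 0 T)
  have i3 := ((i1.const_mul ((p - 1) / 2)).sub i2).const_mul (1 / (p + 1))
  refine i3.congr ?_
  filter_upwards [hweak, ae_restrict_mem measurableSet_Ioo] with t ht hmem
  rw [Pi.sub_apply, hpos t ⟨hmem.1.le, hmem.2⟩, real_inner_comm, ht]
  field_simp
  ring

/-- The energy inequality for weak solutions. -/
theorem IsWeakSolution.ae_energy_add_le (hn : 3 ≤ n) (hb : Bornology.IsBounded Ω)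
    (hm : MeasurableSet Ω) {p : ℝ} (hp₁ : 1 < p) (hp₂ : p < ((n : ℝ) + 2) / ((n : ℝ) - 2))
    {k : ℝ → ℝ} (hk : AssumptionA k) {u₀ : H01 Ω} {u : ℝ → H01 Ω} {T : ℝ}
    (hu : IsWeakSolution p k u₀ u T) {W : ℝ → L2 Ω} (hW : MemLp W 2 volume)
    (hneg : ∀ t ≤ 0, primitive (weighted hn u₀) W t = weighted hn u₀)
    (hpos : ∀ t ∈ Set.Ico 0 T, primitive (weighted hn u₀) W t = weighted hn (u t))
    (hweak : ∀ᵐ t ∂(volume.restrict (Set.Ioo 0 T)), ∀ v : H01 Ω,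
        inner ℝ (W t) (weighted hn v) + inner ℝ (grad (u t)) (grad v) =
          k t * ∫ x in Ω, (|fn (u t) x| ^ (p - 1) * fn (u t) x) * fn v x) :
    ∀ᵐ t, t ∈ Set.Ioo 0 T →
      energy p k (u t) t + ∫ s in (0 : ℝ)..t, ‖W s‖ ^ 2 ≤ energy p k u₀ 0 := by
  obtain ⟨M, hM0, hM, hMu⟩ := ae_norm_le_of_memLp_top hu.memLp u₀
  have hmono := hk.monotoneOn
  have hkpos : ∀ t, 0 ≤ t → 0 ≤ k t := fun t ht =>
    hk.pos.le.trans (hmono Set.self_mem_Ici ht ht)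
  obtain ⟨C, hC⟩ := exists_energy_step_bound hn hb hm hp₁ hp₂ k (κ₀ := k T) hM0
  have hint : IntegrableOn (fun t => energy p k (u t) t) (Set.Ioo 0 T) :=
    integrableOn_energy hn hp₁ hu.pos.le hu.memLp.1 hMu hW hpos
      (hweak.mono fun t ht => inner_eq_of_weak hn hp₁ (ht (u t)))
  -- The energy is extended by its initial value to t ≤ 0, so that differences reaching back before
  -- time 0 compare u(t) with u₀.
  obtain ⟨j, hj0, hj1⟩ : ∃ j : ℝ → ℝ, (∀ t ≤ 0, j t = energy p k u₀ 0) ∧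
      ∀ t, 0 < t → j t = energy p k (u t) t :=
    ⟨fun t => if t ≤ 0 then energy p k u₀ 0 else energy p k (u t) t,
      fun t ht => if_pos ht, fun t ht => if_neg (not_le.2 ht)⟩
  have hji : IntegrableOn j (Set.Ioo 0 T) :=
    hint.congr_fun (fun t ht => (hj1 t ht.1).symm) measurableSet_Ioo
  have hS := (ae_restrict_iff' measurableSet_Ioo).1 (hMu.and hweak)
  have := ae_add_integral_norm_sq_le hW (weighted hn u₀) hu.pos hji hj0 (C := C) hS
    fun s hs t ht hst hmem => ?_
  · filter_upwards [this] with t ht hmem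
    rw [← hj1 t hmem.1]
    exact ht hmem
  · have h1 := (ht hmem).1
    have h2 := (ht hmem).2
    have hkT : k t ≤ k T := hmono hmem.1.le hu.pos.le hmem.2.le
    rw [hj1 t hmem.1, hpos t ⟨hmem.1.le, hmem.2⟩]
    by_cases hs0 : s ≤ 0
    · rw [hj0 s hs0, hneg s hs0]
      exact hC 0 t (u t) u₀ (W t) (hkpos 0 le_rfl)
        (hmono Set.self_mem_Ici hmem.1.le hmem.1.le) hkT h1 hM h2
    · have hs0 : 0 < s := not_le.1 hs0
      have hsT : s < T := hst.trans hmem.2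
      have h3 := (hs ⟨hs0, hsT⟩).1
      rw [hj1 s hs0, hpos s ⟨hs0.le, hsT⟩]
      exact hC s t (u t) (u s) (W t) (hkpos s hs0.le)
        (hmono hs0.le hmem.1.le hst.le) hkT h1 h3 h2

/-- Weak solutions with low initial energy relative to `‖u₀/|x|‖₂²` have bounded lifespan. -/
theorem IsWeakSolution.le_blowUpBound (hn : 3 ≤ n) (hb : Bornology.IsBounded Ω)
    (hm : MeasurableSet Ω) {p : ℝ} (hp₁ : 1 < p) (hp₂ : p < ((n : ℝ) + 2) / ((n : ℝ) - 2))
    {k : ℝ → ℝ} (hk : AssumptionA k) {u₀ : H01 Ω} {u : ℝ → H01 Ω} {T : ℝ}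
    (hu : IsWeakSolution p k u₀ u T) (hJ : 0 < energy p k u₀ 0)
    (hJL : energy p k u₀ 0 < (1 / 2 * weightedNormSq u₀) / C₁ n p) :
    T ≤ blowUpBound p k u₀ := by
  obtain ⟨W, hW, hneg, hpos, hweak⟩ := hu.exists_hilbert_form hn hb hm
  have hen := hu.ae_energy_add_le hn hb hm hp₁ hp₂ hk hW hneg hpos hweak
  have hH := hardyConst_pos hn
  have hp1 : 0 < p - 1 := by linarith
  have hC1 : 0 < C₁ n p := by
    rw [C₁]
    positivity
  rw [lt_div_iff₀ hC1, ← norm_weighted_sq hn] at hJL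
  have hcC : (p - 1) / hardyConst n * C₁ n p = p + 1 := by
    rw [C₁]
    field_simp
  have hc : 0 < (p - 1) / hardyConst n := by positivity
  -- With c = (p-1)/H_n the positivity quantity of `le_of_concavity` is c (L(0) - C₁J(u₀;0)); this c
  -- supplies H_n and the third factor p - 1 of the bound.
  have hm' : (p - 1) / hardyConst n * (1 / 2 * ‖weighted hn u₀‖ ^ 2 - C₁ n p * energy p k u₀ 0) =
      (p - 1) / hardyConst n / 2 * ‖weighted hn u₀‖ ^ 2 - (p + 1) * energy p k u₀ 0 := by
    rw [← hcC]
    ring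
  have key := le_of_concavity hW (weighted hn u₀) (T := T) (c := (p - 1) / hardyConst n)
    (p := p) (J₀ := energy p k u₀ 0) hu.pos hc hp₁ hJ.le ?_ ?_
  · refine key.trans_eq ?_
    rw [← hm', blowUpBound, ← norm_weighted_sq hn]
    have hd : 1 / 2 * ‖weighted hn u₀‖ ^ 2 - C₁ n p * energy p k u₀ 0 ≠ 0 := by
      have : 0 < 1 / 2 * ‖weighted hn u₀‖ ^ 2 - C₁ n p * energy p k u₀ 0 := by linarith
      exact this.ne'
    generalize 1 / 2 * ‖weighted hn u₀‖ ^ 2 - C₁ n p * energy p k u₀ 0 = d at hd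
    field_simp
    ring
  · rw [ae_restrict_iff' measurableSet_Ioo] at hweak
    filter_upwards [hen, hweak] with t h1 h2 hmem
    have h3 := h1 hmem
    rw [hpos t ⟨hmem.1.le, hmem.2⟩, real_inner_comm, inner_eq_of_weak hn hp₁ (h2 hmem (u t))]
    have h4 := norm_weighted_sq_le hn (u t)
    have h5 : (p - 1) / hardyConst n / 2 * ‖weighted hn (u t)‖ ^ 2 ≤
        (p - 1) / 2 * ‖grad (u t)‖ ^ 2 := by
      calc (p - 1) / hardyConst n / 2 * ‖weighted hn (u t)‖ ^ 2
          ≤ (p - 1) / hardyConst n / 2 * (hardyConst n * ‖grad (u t)‖ ^ 2) := by gcongr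
        _ = _ := by field_simp
    have h6 : (p + 1) * energy p k (u t) t ≤
        (p + 1) * (energy p k u₀ 0 - ∫ s in (0 : ℝ)..t, ‖W s‖ ^ 2) :=
      mul_le_mul_of_nonneg_left (by linarith) (by linarith)
    linarith
  · rw [← hm']
    exact mul_pos hc (by linarith)

end WeakSolution

/-! ### Data of arbitrarily high energy -/

section HighEnergyData

variable {n : ℕ} {Ω : Set (E n)}

theorem fn_add (v w : H01 Ω) : fn (v + w) = fn v + fn w := rfl

theorem grad_add (v w : H01 Ω) : grad (v + w) = grad v + grad w := rfl

theorem fn_smul (c : ℝ) (v : H01 Ω) : fn (c • v) = c • fn v := rfl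

theorem grad_smul (c : ℝ) (v : H01 Ω) : grad (c • v) = c • grad v := rfl

theorem energy_eq (p : ℝ) (k : ℝ → ℝ) (v : H01 Ω) (t : ℝ) :
    energy p k v t =
      1 / 2 * ‖grad v‖ ^ 2 - k t / (p + 1) * ∫ x in Ω, |fn v x| ^ (p + 1) := by
  rw [energy, integral_norm_sq_eq]

theorem fn_add_smul_ae (v w : H01 Ω) (s : ℝ) :
    ∀ᵐ x ∂(volume.restrict Ω), fn (v + s • w) x = fn v x + s * fn w x := by
  rw [fn_add, fn_smul]
  filter_upwards [Lp.coeFn_add (fn v) (s • fn w), Lp.coeFn_smul s (fn w)] with x h1 h2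
  rw [h1, Pi.add_apply, h2, Pi.smul_apply, smul_eq_mul]

theorem fn_smul_ae (v : H01 Ω) (c : ℝ) :
    ∀ᵐ x ∂(volume.restrict Ω), fn (c • v) x = c * fn v x := by
  rw [fn_smul]
  filter_upwards [Lp.coeFn_smul c (fn v)] with x h2
  rw [h2, Pi.smul_apply, smul_eq_mul]

theorem integral_rpow_smul (v : H01 Ω) {c : ℝ} (hc : 0 ≤ c) (q : ℝ) :
    ∫ x in Ω, |fn (c • v) x| ^ q = c ^ q * ∫ x in Ω, |fn v x| ^ q := by
  rw [← integral_const_mul]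
  refine integral_congr_ae ?_
  filter_upwards [fn_smul_ae v c] with x hx
  rw [hx, abs_mul, abs_of_nonneg hc, Real.mul_rpow hc (abs_nonneg _)]

theorem weightedNormSq_smul (v : H01 Ω) (c : ℝ) :
    weightedNormSq (c • v) = c ^ 2 * weightedNormSq v := by
  rw [weightedNormSq, weightedNormSq, ← integral_const_mul]
  refine integral_congr_ae ?_
  filter_upwards [fn_smul_ae v c] with x hx
  rw [hx, abs_mul, mul_div_assoc, mul_pow, sq_abs]

theorem abs_add_rpow_le {q : ℝ} (hq : 0 ≤ q) (a b : ℝ) :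
    |a + b| ^ q ≤ 2 ^ q * (|a| ^ q + |b| ^ q) := by
  have h1 : |a + b| ≤ 2 * max |a| |b| := by
    have := abs_add_le a b
    have := le_max_left |a| |b|
    have := le_max_right |a| |b|
    linarith
  have h2 : (max |a| |b|) ^ q ≤ |a| ^ q + |b| ^ q := by
    have ha : 0 ≤ |a| ^ q := by positivity
    have hb : 0 ≤ |b| ^ q := by positivity
    rcases max_choice |a| |b| with h | h <;> rw [h] <;> linarith
  calc |a + b| ^ q ≤ (2 * max |a| |b|) ^ q := by gcongr
    _ = 2 ^ q * (max |a| |b|) ^ q := Real.mul_rpow (by norm_num) (by positivity)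
    _ ≤ _ := by gcongr

theorem integral_rpow_add_le (hn : 3 ≤ n) (hb : Bornology.IsBounded Ω) {q : ℝ} (hq : 0 < q)
    (hq' : q ≤ sobolevExp n) (v w : H01 Ω) :
    ∫ x in Ω, |fn (v + w) x| ^ q ≤
      2 ^ q * ((∫ x in Ω, |fn v x| ^ q) + ∫ x in Ω, |fn w x| ^ q) := by
  have i1 := integrable_abs_fn_rpow hn hb v hq hq'
  have i2 := integrable_abs_fn_rpow hn hb w hq hq'
  rw [← integral_add i1 i2, ← integral_const_mul]
  refine integral_mono_ae (integrable_abs_fn_rpow hn hb (v + w) hq hq')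
    ((i1.add i2).const_mul _) ?_
  filter_upwards [Lp.coeFn_add (fn v) (fn w)] with x hx
  rw [fn_add, hx]
  exact abs_add_rpow_le hq.le _ _

theorem continuousOn_integral_rpow_add_smul (hn : 3 ≤ n) (hb : Bornology.IsBounded Ω) {q : ℝ}
    (hq : 0 < q) (hq' : q ≤ sobolevExp n) (v w : H01 Ω) :
    ContinuousOn (fun s : ℝ => ∫ x in Ω, |fn (v + s • w) x| ^ q) (Set.Icc 0 1) := by
  have i1 := integrable_abs_fn_rpow hn hb v hq hq'
  have i2 := integrable_abs_fn_rpow hn hb w hq hq'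
  have hmv := (Lp.aestronglyMeasurable (fn v)).aemeasurable
  have hmw := (Lp.aestronglyMeasurable (fn w)).aemeasurable
  have key : ContinuousOn (fun s : ℝ => ∫ x in Ω, |fn v x + s * fn w x| ^ q)
      (Set.Icc 0 1) := by
    refine continuousOn_of_dominated
      (bound := fun x => 2 ^ q * (|fn v x| ^ q + |fn w x| ^ q)) (fun s _ => ?_) (fun s hs => ?_)
      ((i1.add i2).const_mul _) (Eventually.of_forall fun x => Continuous.continuousOn ?_)
    · exact ((hmv.add (hmw.const_mul s)).norm.pow_const q).aestronglyMeasurable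
    · refine Eventually.of_forall fun x => ?_
      rw [Real.norm_of_nonneg (by positivity)]
      refine (abs_add_rpow_le hq.le _ _).trans ?_
      have : |s * fn w x| ≤ |fn w x| := by
        rw [abs_mul, abs_of_nonneg hs.1]
        exact mul_le_of_le_one_left (abs_nonneg _) hs.2
      gcongr
    · exact (by fun_prop : Continuous fun s : ℝ => |fn v x + s * fn w x|).rpow_const
        fun _ => Or.inr hq.le
  refine key.congr fun s _ => integral_congr_ae ?_
  filter_upwards [fn_add_smul_ae v w s] with x hx
  rw [hx]

theorem weightedNormSq_le_of_ae_le (hn : 3 ≤ n) {v w : H01 Ω}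
    (h : ∀ᵐ x ∂(volume.restrict Ω), |fn v x| ≤ |fn w x|) :
    weightedNormSq v ≤ weightedNormSq w := by
  have hi : ∀ z : H01 Ω,
      Integrable (fun x => (|fn z x| / ‖x‖) ^ 2) (volume.restrict Ω) := by
    intro z
    refine (memLp_weighted hn z).integrable_sq.congr (Eventually.of_forall fun x => ?_)
    simp only
    rw [mul_pow, div_pow, sq_abs, inv_pow, div_eq_inv_mul]
  refine integral_mono_ae (hi v) (hi w) ?_
  filter_upwards [h] with x hx
  gcongr

/-- Along a segment in the cone of nonnegative functions the energy takes all intermediate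
values, and the weighted norm does not decrease. -/
theorem exists_energy_eq (hn : 3 ≤ n) (hb : Bornology.IsBounded Ω) {p : ℝ} (hp : 0 < p + 1)
    (hp' : p + 1 ≤ sobolevExp n) {k : ℝ → ℝ} {t R : ℝ} {v w : H01 Ω}
    (hv : ∀ᵐ x ∂(volume.restrict Ω), 0 ≤ fn v x) (hw : ∀ᵐ x ∂(volume.restrict Ω), 0 ≤ fn w x)
    (h1 : energy p k v t ≤ R) (h2 : R ≤ energy p k (v + w) t) :
    ∃ z : H01 Ω, (∀ᵐ x ∂(volume.restrict Ω), 0 ≤ fn z x) ∧ energy p k z t = R ∧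
      weightedNormSq v ≤ weightedNormSq z := by
  have hc : ContinuousOn (fun s : ℝ => energy p k (v + s • w) t) (Set.Icc 0 1) := by
    simp only [energy_eq, grad_add, grad_smul]
    refine ContinuousOn.sub (Continuous.continuousOn ?_)
      (continuousOn_const.mul (continuousOn_integral_rpow_add_smul hn hb hp hp' v w))
    fun_prop
  have := intermediate_value_Icc zero_le_one hc
  simp only [zero_smul, add_zero, one_smul] at this
  obtain ⟨s, hs, hsR⟩ := this ⟨h1, h2⟩
  refine ⟨v + s • w, ?_, hsR, weightedNormSq_le_of_ae_le hn ?_⟩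
  · filter_upwards [fn_add_smul_ae v w s, hv, hw] with x hx h3 h4
    rw [hx]
    exact add_nonneg h3 (mul_nonneg hs.1 h4)
  · filter_upwards [fn_add_smul_ae v w s, hv, hw] with x hx h3 h4
    have h5 := mul_nonneg hs.1 h4
    rw [hx, abs_of_nonneg h3, abs_of_nonneg (add_nonneg h3 h5)]
    linarith

theorem IsTestFunction.exists_mem_H01 {φ : E n → ℝ} (hφ : IsTestFunction Ω φ) :
    ∃ v : H01 Ω, fn v =ᵐ[volume.restrict Ω] φ ∧ grad v =ᵐ[volume.restrict Ω] ∇ φ := by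
  have h1 := (hφ.memLp 2).restrict Ω
  have h2 := (hφ.memLp_gradient 2).restrict Ω
  exact ⟨⟨WithLp.toLp 2 (h1.toLp φ, h2.toLp (∇ φ)), mem_H01_iff.2 (subset_closure
    ⟨φ, hφ, h1.coeFn_toLp, h2.coeFn_toLp⟩)⟩, h1.coeFn_toLp, h2.coeFn_toLp⟩

theorem weightedNormSq_pos (hn : 3 ≤ n) {q : ℝ} (hq : q ≠ 0) {v : H01 Ω}
    (hv : 0 < ∫ x in Ω, |fn v x| ^ q) : 0 < weightedNormSq v := by
  rw [← norm_weighted_sq hn]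
  refine pow_pos (norm_pos_iff.2 fun h0 => hv.ne' ?_) 2
  have h1 := (Lp.eq_zero_iff_ae_eq_zero).1 h0
  refine integral_eq_zero_of_ae ?_
  filter_upwards [h1, coeFn_weighted hn v, ae_ne_zero hn] with x h2 h3 h4
  rw [h3, Pi.zero_apply, mul_eq_zero] at h2
  have h5 := h2.resolve_left (inv_ne_zero (norm_ne_zero_iff.2 h4))
  rw [h5, abs_zero, Real.zero_rpow hq, Pi.zero_apply]

theorem isTestFunction_comp_smul (hΩ : IsOpen Ω) (h0 : (0 : E n) ∈ Ω) {ζ : E n → ℝ}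
    (hζ : IsTestFunction Set.univ ζ) :
    ∀ᶠ l : ℝ in atTop, IsTestFunction Ω fun x => ζ (l • x) := by
  obtain ⟨r, hr, hball⟩ := Metric.isOpen_iff.1 hΩ 0 h0
  obtain ⟨S, hS⟩ := hζ.2.1.isBounded.exists_norm_le
  filter_upwards [eventually_gt_atTop 0, eventually_gt_atTop (S / r)] with l hl0 hl
  refine ⟨hζ.1.comp (contDiff_const_smul l), hζ.2.1.comp_smul hl0.ne', fun x hx => hball ?_⟩
  have h1 : l • x ∈ tsupport ζ :=
    tsupport_comp_subset_preimage ζ (f := fun x => l • x) (by fun_prop) hx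
  have h2 := hS _ h1
  rw [norm_smul, Real.norm_of_nonneg hl0.le] at h2
  rw [div_lt_iff₀ hr] at hl
  rw [mem_ball_zero_iff]
  exact lt_of_mul_lt_mul_left (h2.trans_lt hl) hl0.le

theorem IsTestFunction.integral_comp_smul {ζ : E n → ℝ} {l : ℝ} (hl : 0 ≤ l) {q : ℝ} (hq : q ≠ 0)
    (h : IsTestFunction Ω fun x => ζ (l • x)) :
    ∫ x in Ω, |ζ (l • x)| ^ q = (l ^ n)⁻¹ * ∫ x, |ζ x| ^ q := by
  rw [setIntegral_eq_integral_of_forall_compl_eq_zero]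
  · have := Measure.integral_comp_smul_of_nonneg (volume : Measure (E n))
      (fun x => |ζ x| ^ q) l (hR := hl)
    simpa using this
  · intro x hx
    have : ζ (l • x) = 0 := by
      by_contra h1
      exact hx (h.support_subset h1)
    rw [this, abs_zero, Real.zero_rpow hq]

theorem IsTestFunction.integral_gradient_comp_smul {ζ : E n → ℝ} {l : ℝ} (hl : 0 ≤ l)
    (h : IsTestFunction Ω fun x => ζ (l • x)) :
    ∫ x in Ω, ‖∇ (fun x => ζ (l • x)) x‖ ^ 2 =
      l ^ 2 * ((l ^ n)⁻¹ * ∫ x, ‖fderiv ℝ ζ x‖ ^ 2) := by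
  rw [setIntegral_eq_integral_of_forall_compl_eq_zero]
  · have := Measure.integral_comp_smul_of_nonneg (volume : Measure (E n))
      (fun x => ‖fderiv ℝ ζ x‖ ^ 2) l (hR := hl)
    simp only [finrank_euclideanSpace, Fintype.card_fin, smul_eq_mul] at this
    rw [← this, ← integral_const_mul]
    refine integral_congr_ae (Eventually.of_forall fun x => ?_)
    simp only
    rw [norm_gradient_eq, fderiv_comp_smul, norm_smul, mul_pow, Real.norm_of_nonneg hl]
  · intro x hx
    have : ∇ (fun x => ζ (l • x)) x = 0 := by
      by_contra h1
      exact hx (h.support_gradient_subset h1)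
    simp [this]

/-- For a subcritical exponent there are nonnegative functions with arbitrarily large gradient
and bounded `L^q` norm. -/
theorem exists_large_grad (hn : 3 ≤ n) (hΩ : IsOpen Ω) (h0 : (0 : E n) ∈ Ω) {q : ℝ} (hq : 0 < q)
    (hq' : q < sobolevExp n) :
    ∃ B : ℝ, 0 < B ∧ ∀ K : ℝ, ∃ v : H01 Ω, (∀ᵐ x ∂(volume.restrict Ω), 0 ≤ fn v x) ∧
      K ≤ ‖grad v‖ ^ 2 ∧ ∫ x in Ω, |fn v x| ^ q = B := by
  have hn' : (3 : ℝ) ≤ n := by exact_mod_cast hn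
  let b : ContDiffBump (0 : E n) := ⟨1, 2, one_pos, one_lt_two⟩
  have hζ : IsTestFunction Set.univ (b : E n → ℝ) :=
    ⟨b.contDiff, b.hasCompactSupport, Set.subset_univ _⟩
  have hB : 0 < ∫ x, |b x| ^ q := by
    refine Continuous.integral_pos_of_hasCompactSupport_nonneg_nonzero (x := 0)
      (b.continuous.abs.rpow_const fun _ => Or.inr hq.le)
      (b.hasCompactSupport.comp_left (g := fun y : ℝ => |y| ^ q) (by simp [hq.ne']))
      (fun x => by positivity) ?_
    rw [b.one_of_mem_closedBall (by simp [b])]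
    simp
  set B := ∫ x, |b x| ^ q
  set A := ∫ x, ‖fderiv ℝ b x‖ ^ 2 with hAdef
  have hex : ∀ᶠ l : ℝ in atTop, ∃ v : H01 Ω, (∀ᵐ x ∂(volume.restrict Ω), 0 ≤ fn v x) ∧
      ‖grad v‖ ^ 2 = l ^ 2 * ((l ^ n)⁻¹ * A) ∧ ∫ x in Ω, |fn v x| ^ q = (l ^ n)⁻¹ * B := by
    filter_upwards [isTestFunction_comp_smul hΩ h0 hζ, eventually_gt_atTop 0] with l hl hl0
    obtain ⟨v, hv, hg⟩ := hl.exists_mem_H01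
    refine ⟨v, ?_, ?_, ?_⟩
    · filter_upwards [hv] with x hx
      rw [hx]
      exact b.nonneg
    · rw [← integral_norm_sq_eq, ← hl.integral_gradient_comp_smul hl0.le]
      exact integral_congr_ae (hg.mono fun x hx => by simp only [hx])
    · rw [← hl.integral_comp_smul hl0.le hq.ne']
      exact integral_congr_ae (hv.mono fun x hx => by simp only [hx])
  -- By Hardy's inequality, a vanishing gradient would force the rescaled bump to vanish.
  have hA : 0 < A := by
    obtain ⟨l, ⟨v, -, h1, h2⟩, hl⟩ := (hex.and (eventually_gt_atTop 0)).exists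
    have h3 : 0 < weightedNormSq v := by
      refine weightedNormSq_pos hn hq.ne' ?_
      rw [h2]
      positivity
    rw [← norm_weighted_sq hn] at h3
    have h4 := h3.trans_le (norm_weighted_sq_le hn v)
    rw [h1] at h4
    have h5 := pos_of_mul_pos_right h4 (hardyConst_pos hn).le
    exact pos_of_mul_pos_right (pos_of_mul_pos_right h5 (by positivity)) (by positivity)
  refine ⟨B, hB, fun K => ?_⟩
  -- The amplitude l^{n/q} keeps the L^q norm of the rescaled bump fixed, and its squared gradient
  -- norm is then l^δ A; δ > 0 because q < 2*.
  set δ : ℝ := 2 * n / q + 2 - n with hδ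
  have hδ0 : 0 < δ := by
    rw [sobolevExp, lt_div_iff₀ (by linarith)] at hq'
    have : (n : ℝ) - 2 < 2 * n / q := by
      rw [lt_div_iff₀ hq]
      linarith
    linarith
  obtain ⟨l, ⟨⟨v, hv, h1, h2⟩, hl⟩, hK⟩ := ((hex.and (eventually_gt_atTop 0)).and
    ((tendsto_rpow_atTop hδ0).eventually_ge_atTop (K / A))).exists
  have hln : (l ^ n) = l ^ (n : ℝ) := (Real.rpow_natCast l n).symm
  refine ⟨(l ^ (n / q : ℝ)) • v, ?_, ?_, ?_⟩
  · filter_upwards [fn_smul_ae v (l ^ (n / q : ℝ)), hv] with x hx h3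
    rw [hx]
    positivity
  · rw [grad_smul, norm_smul, mul_pow, h1, Real.norm_of_nonneg (by positivity)]
    rw [div_le_iff₀ hA] at hK
    refine hK.trans_eq ?_
    rw [hδ, Real.rpow_sub hl, Real.rpow_add hl, hln, ← Real.rpow_mul_natCast hl.le]
    norm_num
    rw [show (n : ℝ) / q * 2 = 2 * n / q by ring]
    field_simp
  · rw [integral_rpow_smul v (by positivity), h2, ← Real.rpow_mul hl.le,
      div_mul_cancel₀ _ hq.ne', hln]
    field_simp

/-- The negative term grows like c^{p+1} and beats the quadratic one: for large c the energy is at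
most -c², hence at most R. -/
theorem exists_smul_energy_le {p : ℝ} (hp : 1 < p) {k : ℝ → ℝ} {t : ℝ} (hk : 0 < k t) {v : H01 Ω}
    (hv : 0 < ∫ x in Ω, |fn v x| ^ (p + 1)) (hw : 0 < weightedNormSq v) (R K : ℝ) :
    ∃ c : ℝ, 0 ≤ c ∧ energy p k (c • v) t ≤ R ∧ K < weightedNormSq (c • v) := by
  set N := ∫ x in Ω, |fn v x| ^ (p + 1) with hN
  have hlim : Tendsto (fun c : ℝ => k t / (p + 1) * N * c ^ (p - 1)) atTop atTop :=
    (tendsto_rpow_atTop (by linarith)).const_mul_atTop (by positivity)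
  have hsq : Tendsto (fun c : ℝ => c ^ 2) atTop atTop := tendsto_pow_atTop two_ne_zero
  obtain ⟨c, ⟨⟨hc0, h1⟩, h2⟩, h3⟩ := (((eventually_gt_atTop 0).and
    (hlim.eventually_ge_atTop (1 / 2 * ‖grad v‖ ^ 2 + 1))).and
    (hsq.eventually_ge_atTop (-R))).and (hsq.eventually_gt_atTop (K / weightedNormSq v)) |>.exists
  refine ⟨c, hc0.le, ?_, ?_⟩
  · rw [energy_eq, integral_rpow_smul v hc0.le, grad_smul, norm_smul, mul_pow,
      Real.norm_of_nonneg hc0.le, ← hN, show p + 1 = p - 1 + (2 : ℕ) by push_cast; ring,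
      Real.rpow_add_natCast hc0.ne']
    rw [show p - 1 + (2 : ℕ) = p + 1 by push_cast; ring]
    have h4 := mul_le_mul_of_nonneg_left h1 (sq_nonneg c)
    linarith
  · rw [weightedNormSq_smul]
    rwa [div_lt_iff₀ hw] at h3

/-- Nonnegative functions with prescribed energy and arbitrarily large weighted norm. -/
theorem exists_energy_eq_lt_weightedNormSq (hn : 3 ≤ n) (hb : Bornology.IsBounded Ω)
    (hΩ : IsOpen Ω) (h0 : (0 : E n) ∈ Ω) {p : ℝ} (hp₁ : 1 < p)
    (hp₂ : p < ((n : ℝ) + 2) / ((n : ℝ) - 2)) {k : ℝ → ℝ} {t : ℝ} (hk : 0 < k t) (R K : ℝ) :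
    ∃ z : H01 Ω, (∀ᵐ x ∂(volume.restrict Ω), 0 ≤ fn z x) ∧ energy p k z t = R ∧
      K < weightedNormSq z := by
  have hp : 0 < p + 1 := by linarith
  have hq := add_one_lt_sobolevExp hn hp₂
  obtain ⟨B, hB, hex⟩ := exists_large_grad hn hΩ h0 hp hq
  obtain ⟨v₀, hv₀, -, hN₀⟩ := hex 0
  have hN₀' : 0 < ∫ x in Ω, |fn v₀ x| ^ (p + 1) := hN₀ ▸ hB
  obtain ⟨c, hc, hcR, hcK⟩ := exists_smul_energy_le hp₁ hk hN₀'
    (weightedNormSq_pos hn hp.ne' hN₀') R K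
  have hcv : ∀ᵐ x ∂(volume.restrict Ω), 0 ≤ fn (c • v₀) x := by
    filter_upwards [fn_smul_ae v₀ c, hv₀] with x hx h1
    rw [hx]
    positivity
  generalize c • v₀ = v at hcR hcK hcv
  -- P bounds the power term of v + w for every w whose L^{p+1} integral is B, independently of its
  -- gradient. The gradient can therefore be chosen afterwards, large enough that ½‖∇(v + w)‖² ≥ R +
  -- P.
  set P := k t / (p + 1) * (2 ^ (p + 1) * ((∫ x in Ω, |fn v x| ^ (p + 1)) + B)) with hP
  obtain ⟨w, hw, hgw, hNw⟩ := hex (4 * (R + P) + 2 * ‖grad v‖ ^ 2)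
  obtain ⟨z, hz, hzR, hzw⟩ := exists_energy_eq hn hb hp hq.le hcv hw hcR (by
    rw [energy_eq, grad_add]
    have h1 := integral_rpow_add_le hn hb hp hq.le v w
    rw [hNw] at h1
    have h2 : k t / (p + 1) * ∫ x in Ω, |fn (v + w) x| ^ (p + 1) ≤ P :=
      mul_le_mul_of_nonneg_left h1 (by positivity)
    have h3 : ‖grad w‖ ^ 2 ≤ 2 * ‖grad v + grad w‖ ^ 2 + 2 * ‖grad v‖ ^ 2 := by
      have := parallelogram_law_with_norm ℝ (grad v + grad w) (grad v)
      rw [add_sub_cancel_left] at this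
      nlinarith [sq_nonneg ‖grad v + grad w + grad v‖]
    linarith)
  exact ⟨z, hz, hzR, hcK.trans_le hzw⟩

end HighEnergyData

end SpecialDiffusion

/-! ### The theorem -/

theorem theorem3p3 (n : ℕ) (hn : 3 ≤ n) (Ω : Set (SpecialDiffusion.E n))
    (hΩ : SpecialDiffusion.IsSmoothBoundedDomain Ω)
    (p : ℝ) (hp₁ : 1 < p) (hp₂ : p < ((n : ℝ) + 2) / ((n : ℝ) - 2))
    (k : ℝ → ℝ) (hk : SpecialDiffusion.AssumptionA k) :
    -- the blow-up result for every admissible datum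
    (∀ u₀ : SpecialDiffusion.H01 Ω,
      (∀ᵐ x ∂(volume.restrict Ω), 0 ≤ SpecialDiffusion.fn u₀ x) → u₀ ≠ 0 →
      0 < SpecialDiffusion.energy p k u₀ 0 →
      SpecialDiffusion.energy p k u₀ 0 <
        (1 / 2 * SpecialDiffusion.weightedNormSq u₀) / SpecialDiffusion.C₁ n p →
      ∀ u : ℝ → SpecialDiffusion.H01 Ω,
        -- no weak solution exists on a time interval longer than the bound
        (∀ T : ℝ, SpecialDiffusion.IsWeakSolution p k u₀ u T →
          T ≤ SpecialDiffusion.blowUpBound p k u₀) ∧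
        -- the maximal existence time is finite, is a blow-up time, and obeys the bound
        (∀ Tmax : EReal, SpecialDiffusion.IsMaximalExistenceTime p k u₀ u Tmax →
          ∃ T₀ : ℝ, Tmax = T₀ ∧ SpecialDiffusion.BlowsUpAt p k u₀ u T₀ ∧
            T₀ ≤ SpecialDiffusion.blowUpBound p k u₀)) ∧
    -- admissible data exist at every positive energy level
    (∀ R : ℝ, 0 < R → ∃ u₀ : SpecialDiffusion.H01 Ω,
      (∀ᵐ x ∂(volume.restrict Ω), 0 ≤ SpecialDiffusion.fn u₀ x) ∧ u₀ ≠ 0 ∧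
      SpecialDiffusion.energy p k u₀ 0 = R ∧
      R < (1 / 2 * SpecialDiffusion.weightedNormSq u₀) / SpecialDiffusion.C₁ n p) := by
  have hb := hΩ.isBounded
  have hbound : ∀ u₀ : SpecialDiffusion.H01 Ω, 0 < SpecialDiffusion.energy p k u₀ 0 →
      SpecialDiffusion.energy p k u₀ 0 <
        (1 / 2 * SpecialDiffusion.weightedNormSq u₀) / SpecialDiffusion.C₁ n p →
      ∀ u : ℝ → SpecialDiffusion.H01 Ω, ∀ T : ℝ, SpecialDiffusion.IsWeakSolution p k u₀ u T →
        T ≤ SpecialDiffusion.blowUpBound p k u₀ := fun u₀ hJ hJL u T hu =>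
    hu.le_blowUpBound hn hb hΩ.isOpen.measurableSet hp₁ hp₂ hk hJ hJL
  refine ⟨fun u₀ _ _ hJ hJL u => ⟨hbound u₀ hJ hJL u, fun Tmax hT => ?_⟩, fun R hR => ?_⟩
  · rcases hT with ⟨T₀, hT₀, hblow⟩ | ⟨-, hglobal⟩
    -- A weak solution is given only on (0,S) for S < T₀, so the bound is passed to the supremum.
    -- For S ≤ 0 it suffices that the bound is at least T₀/2 > 0.
    · exact ⟨T₀, hT₀, hblow, le_of_forall_lt_imp_le_of_dense fun S hS => by
        rcases le_or_gt S 0 with h0 | h0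
        · exact h0.trans ((half_pos hblow.1).le.trans (hbound u₀ hJ hJL u _
            (hblow.2.1 _ ⟨half_pos hblow.1, half_lt_self hblow.1⟩)))
        · exact hbound u₀ hJ hJL u S (hblow.2.1 S ⟨h0, hS⟩)⟩
    · have h1 : 0 < |SpecialDiffusion.blowUpBound p k u₀| + 1 := by positivity
      have h2 := hbound u₀ hJ hJL u _ (hglobal.1 _ h1)
      linarith [le_abs_self (SpecialDiffusion.blowUpBound p k u₀)]
  · have hH := SpecialDiffusion.hardyConst_pos hn
    have hp1 : 0 < p - 1 := by linarith
    have hC : 0 < SpecialDiffusion.C₁ n p := by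
      rw [SpecialDiffusion.C₁]
      positivity
    -- The threshold 2RC₁ accounts for the factor ½ in L(0).
    obtain ⟨z, hz, hzR, hzK⟩ := SpecialDiffusion.exists_energy_eq_lt_weightedNormSq hn hb hΩ.isOpen
      hΩ.zero_mem hp₁ hp₂ (t := 0) hk.pos R (2 * (R * SpecialDiffusion.C₁ n p))
    refine ⟨z, hz, ?_, hzR, ?_⟩
    · rintro rfl
      have h1 : (0 : ℝ) ≤ 2 * (R * SpecialDiffusion.C₁ n p) := by positivity
      have h2 := SpecialDiffusion.weightedNormSq_smul (0 : SpecialDiffusion.H01 Ω) 0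
      rw [smul_zero] at h2
      linarith
    · rw [lt_div_iff₀ hC]
      linarith
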